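/- Let $d\ge 1$, let $G\subset\mathbb{R}^d$ be a bounded open set (in particular, any bounded Lipschitz domain), let $G_0\subset G$ be measurable with positive Lebesgue measure, let $\alpha\in(0,1)$ and $T>0$. Let $y_0\in L^2(G)=L^2(G;\mathbb{C})$ with $y_0\neq 0$, and let $u\in L^\infty((0,T)\times G_0)$ be complex-valued. For $\xi\in\mathbb{R}$ consider the time-fractional Schrödinger system $$\partial^{\alpha}_{0,t}y-\xi\,\mathrm{i}\,\Delta y=\mathbf 1_{G_0}u \ \text{ in } (0,T)\times G,\qquad y=0\ \text{ on } (0,T)\times\partial G,\qquad y(0,\cdot)=y_0\ \text{ in } G, \tag{$\mathcal P_\xi$}$$ where $\partial^\alpha_{0,t}$ is the Caputo derivative of order $\alpha$. A weak solution of $(\mathcal P_\xi)$ is a function $y\in C([0,T];L^2(G))$ with $y(0)=y_0$ such that, for every $\varphi$ in the domain of the Dirichlet Laplacian (that is, $\varphi\in H^1_0(G)$ with $\Delta\varphi\in L^2(G)$), $$\partial^\alpha_{0,t}\langle y(t),\varphi\rangle=\xi\,\mathrm i\,\langle y(t),\Delta\varphi\rangle+\langle \mathbf 1_{G_0}u(t,\cdot),\varphi\rangle\quad\text{on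 }(0,T).$$ Here $\langle f,\varphi\rangle=\int_G f\,\overline{\varphi}\,dx$, and for continuous $g:[0,T]\to\mathbb{C}$ the identity $\partial^\alpha_{0,t}g=f$ means that $f\in L^1(0,T)$ and $$\frac1{\Gamma(1-\alpha)}\int_0^t (t-s)^{-\alpha}\,(g(s)-g(0))\,ds=\int_0^t f(s)\,ds\qquad\text{for all } t\in[0,T].$$ Then the set of all $\xi\in\mathbb{R}$ for which $(\mathcal P_\xi)$ has a weak solution $y$ with $y(T)=0$ is countable. Consequently, simultaneous null controllability fails almost surely for absolutely continuous diffusivities: if $(\Omega,\mathcal F,\mathbb P)$ is a probability space and $\xi:\Omega\to\mathbb{R}$ is a random variable whose law is absolutely continuous with respect to Lebesgue measure, then $$\mathbb P\big[\{\omega\in\Omega : (\mathcal P_{\xi(\omega)})\text{ has a weak solution } y \text{ with } y(T)=0\}\big]=0 .$$ -/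

import Mathlib

open MeasureTheory Filter Topology Set
open scoped ComplexConjugate ENNReal

namespace FracSchrodinger

/-- The complex Hilbert space `L²(G) = L²(G; ℂ)` with respect to Lebesgue measure. -/
abbrev L2 {d : ℕ} (G : Set (EuclideanSpace ℝ (Fin d))) : Type :=
  Lp ℂ 2 (volume.restrict G)

/-- Test functions on `G`: smooth, with compact support contained in `G`. -/
def IsTestFunction {d : ℕ} (G : Set (EuclideanSpace ℝ (Fin d)))
    (ψ : EuclideanSpace ℝ (Fin d) → ℂ) : Prop :=
  ContDiff ℝ ((⊤ : ℕ∞) : WithTop ℕ∞) ψ ∧ HasCompactSupport ψ ∧ tsupport ψ ⊆ G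

/-- The classical partial derivative `∂ᵢψ`. -/
noncomputable def partialDeriv {d : ℕ} (i : Fin d) (ψ : EuclideanSpace ℝ (Fin d) → ℂ)
    (x : EuclideanSpace ℝ (Fin d)) : ℂ :=
  fderiv ℝ ψ x (EuclideanSpace.single i 1)

/-- `φ ∈ H¹₀(G)` with weak gradient `D`: the pair `(φ, D)` is a limit, in `L²(G)`, of pairs
`(ψ, ∇ψ)` with `ψ` a test function on `G` (so `H¹₀(G)` is the closure of `C_c^∞(G)` in
`H¹(G)`). -/
def IsH10WithGradient {d : ℕ} (G : Set (EuclideanSpace ℝ (Fin d)))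
    (φ : L2 G) (D : Fin d → L2 G) : Prop :=
  ∃ ψ : ℕ → EuclideanSpace ℝ (Fin d) → ℂ,
    (∀ k, IsTestFunction G (ψ k)) ∧
    Tendsto (fun k => eLpNorm (fun x => φ x - ψ k x) 2 (volume.restrict G)) atTop (𝓝 0) ∧
    ∀ i, Tendsto
      (fun k => eLpNorm (fun x => D i x - partialDeriv i (ψ k) x) 2 (volume.restrict G))
      atTop (𝓝 0)

/-- `φ` lies in the domain of the Dirichlet Laplacian of `G`, and `Δφ = g`: that is,
`φ ∈ H¹₀(G)`, `g ∈ L²(G)` and `∫ g ψ̄ = -∫ ∇φ · ∇ψ̄` for all test functions `ψ` on `G`. -/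
def HasDirichletLaplacian {d : ℕ} (G : Set (EuclideanSpace ℝ (Fin d))) (φ g : L2 G) : Prop :=
  ∃ D : Fin d → L2 G, IsH10WithGradient G φ D ∧
    ∀ ψ : EuclideanSpace ℝ (Fin d) → ℂ, IsTestFunction G ψ →
      ∫ x in G, g x * conj (ψ x) = -∑ i, ∫ x in G, D i x * conj (partialDeriv i ψ x)

/-- The left Riemann–Liouville fractional integral
`(I^β g)(t) = Γ(β)⁻¹ ∫₀ᵗ (t - s)^(β - 1) g(s) ds`. -/
noncomputable def fracIntegral (β : ℝ) (g : ℝ → ℂ) (t : ℝ) : ℂ :=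
  ∫ s in (0 : ℝ)..t, (((t - s) ^ (β - 1) / Real.Gamma β : ℝ) : ℂ) * g s

/-- The function `g` has the integrable function `f` as its Caputo derivative of order
`α ∈ (0,1)` on `(0,T)`: the function `I^(1-α) (g - g(0))` is absolutely continuous on `[0,T]`
with value `0` at `0` and derivative `f` almost everywhere. If `g` is itself absolutely
continuous, this says `f = I^(1-α) g'`, because
`I^(1-α) (g - g(0)) = I^(1-α) I^1 g' = I^1 I^(1-α) g'`. -/
def HasCaputoDeriv (α T : ℝ) (g f : ℝ → ℂ) : Prop :=
  IntervalIntegrable f volume 0 T ∧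
    ∀ t ∈ Icc (0 : ℝ) T, fracIntegral (1 - α) (fun s => g s - g 0) t = ∫ s in (0 : ℝ)..t, f s

/-- `y` is a weak solution in `C([0,T]; L²(G))` of the time-fractional Schrödinger system
`∂ₜ^α y - ξ i Δy = 1_{G₀} u` in `(0,T) × G`, `y = 0` on `(0,T) × ∂G`, `y(0) = y₀`.
The equation and the boundary condition hold in the dual of the domain of the Dirichlet
Laplacian: `∂ₜ^α ⟨y, φ⟩ = ξ i ⟨y, Δφ⟩ + ⟨1_{G₀} u, φ⟩` for all `φ` in that domain. The product
`⟨f, φ⟩ = ∫ f φ̄` of two elements of `L²(G)` is written `inner ℂ φ f`. -/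
def IsWeakSolution {d : ℕ} (G G₀ : Set (EuclideanSpace ℝ (Fin d))) (α T ξ : ℝ)
    (y₀ : L2 G) (u : ℝ × EuclideanSpace ℝ (Fin d) → ℂ) (y : ℝ → L2 G) : Prop :=
  ContinuousOn y (Icc 0 T) ∧ y 0 = y₀ ∧
    ∀ φ Δφ : L2 G, HasDirichletLaplacian G φ Δφ →
      HasCaputoDeriv α T (fun t => inner ℂ φ (y t))
        (fun t => (ξ : ℂ) * Complex.I * inner ℂ Δφ (y t) + ∫ x in G₀, u (t, x) * conj (φ x))

end FracSchrodinger

/-! Let `K` be the inverse of the negative Dirichlet Laplacian. Suppose `φ k` is a chain with `-Δ (φ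
k) = φ (k + 1)` and `‖φ k‖ ≤ C * R ^ k`. Pairing a weak solution with the chain gives scalar
equations `∂ₜ^α Y k = z Y (k + 1) + v k`, where `z = -ξ i` and `v k` is the pairing of the control
with `φ k`. Iterating them expresses `Y 0 T` as a power series in `z` (`hasSum_chainCoeff`). Its
coefficients involve only `y₀`, `u` and the chain, not `ξ`, and the growth of Gamma makes the series
entire. If `y T = 0`, then `-ξ i` is a zero of this entire function, so only countably many `ξ`
occur unless every coefficient vanishes.

The chain must therefore have a nonzero coefficient. Coefficient `p` depends on the chain only
through `φ p`. For a fixed `ψ` with `⟨y₀, ψ⟩ ≠ 0`, the control term is smaller than the initial term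
by a factor `Γ(αp + 1) / Γ(αp + 1 + α) → 0`, so some `p` works (`exists_chainCoeff_ne_zero`). The
chain is then started at `K ^ p ψ`, so that it passes through `ψ` at index `p`.

To continue the chain past `ψ` with geometric growth, `ψ` is taken in a part of the space where `K`
has a bounded inverse `B`. Functional calculus supplies it for any injective self-adjoint `K`
(`exists_inner_ne_zero_of_bounded_inverse`), so neither eigenfunctions nor compactness of `K` are
needed. Countable sets are Lebesgue null, which gives the probabilistic statement. -/

namespace FracSchrodinger

/-! ### Spectral truncation of a self-adjoint operator -/

/-- For an injective self-adjoint bounded operator `K`, no nonzero vector is orthogonal to all the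
vectors on which `K` has a bounded two-sided inverse commuting with `K`. -/
theorem exists_inner_ne_zero_of_bounded_inverse {H : Type*} [NormedAddCommGroup H]
    [InnerProductSpace ℂ H] [CompleteSpace H] (K : H →L[ℂ] H) (hK : IsSelfAdjoint K)
    (hinj : Function.Injective K) {y : H} (hy : y ≠ 0) :
    ∃ (ψ : H) (B : H →L[ℂ] H), inner ℂ ψ y ≠ 0 ∧ Commute B K ∧ K (B ψ) = ψ := by
  have hKy : K y ≠ 0 := fun h => hy (hinj (by simpa using h))
  have hy' : 0 < ‖y‖ := norm_pos_iff.2 hy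
  have hKy' : 0 < ‖K y‖ := norm_pos_iff.2 hKy
  -- Chosen so that an error of norm `δ` in replacing `K` by `F` changes `⟨K (K y), y⟩ = ‖K y‖ ^ 2`
  -- by at most half of its value.
  set δ : ℝ := ‖K y‖ / (2 * ‖y‖) with hδ
  have hδ0 : 0 < δ := by positivity
  -- Soft thresholding: continuous, zero on `[-δ, δ]`, and within `δ` of the identity. The function
  -- `b` below is continuous and equals `1 / x` for `|x| ≥ δ`, hence inverts `x` wherever `f` is
  -- nonzero.
  set f : ℝ → ℝ := fun x => x - max (-δ) (min δ x) with hf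
  set b : ℝ → ℝ := fun x => x / max (x ^ 2) (δ ^ 2) with hb
  have hfc : Continuous f := by fun_prop
  have hbc : Continuous b := by
    refine Continuous.div continuous_id (by fun_prop) fun x => ?_
    have : 0 < max (x ^ 2) (δ ^ 2) := lt_max_of_lt_right (by positivity)
    exact this.ne'
  have hfb : ∀ x, x * (b x * f x) = f x := by
    intro x
    by_cases hx : |x| ≤ δ
    · have h := abs_le.1 hx
      have : f x = 0 := by simp [hf, min_eq_right h.2, max_eq_right h.1]
      simp [this]
    · have h1 : δ ^ 2 ≤ x ^ 2 := by
        rw [← sq_abs x]; exact pow_le_pow_left₀ hδ0.le (not_le.1 hx).le 2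
      have h2 : x ≠ 0 := by rintro rfl; simp [hδ0.le] at hx
      simp only [hb, max_eq_left h1]
      field_simp
  set F : H →L[ℂ] H := cfc f K
  set B : H →L[ℂ] H := cfc b K
  have hKBF : K * (B * F) = F := by
    have h1 : B * F = cfc (fun x => b x * f x) K :=
      (cfc_mul b f K hbc.continuousOn hfc.continuousOn).symm
    have h2 : K * cfc (fun x => b x * f x) K = cfc (fun x => x * (b x * f x)) K := by
      conv_lhs => enter [1]; rw [← cfc_id' ℝ K]
      exact (cfc_mul (fun x => x) (fun x => b x * f x) K continuousOn_id
        (hbc.mul hfc).continuousOn).symm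
    rw [h1, h2]
    simp_rw [hfb]
    rfl
  have hFK : ‖F - K‖ ≤ δ := by
    have h1 : F - K = cfc (fun x => f x - x) K := by
      rw [cfc_sub f (fun x => x) K hfc.continuousOn continuousOn_id, cfc_id' ℝ K]
    rw [h1]
    refine norm_cfc_le hδ0.le fun x _ => ?_
    simp only [hf, Real.norm_eq_abs, sub_sub_cancel_left, abs_neg]
    exact abs_le.2 ⟨le_max_left _ _, max_le (by linarith) (min_le_left _ _)⟩
  refine ⟨F (K y), B, ?_, ?_, ?_⟩
  · intro h0
    have h1 : inner ℂ (K (K y)) y = ((‖K y‖ ^ 2 : ℝ) : ℂ) := by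
      have := (ContinuousLinearMap.isSelfAdjoint_iff_isSymmetric.1 hK) (K y) y
      simp only [ContinuousLinearMap.coe_coe] at this
      rw [this, inner_self_eq_norm_sq_to_K]; norm_cast
    have h2 : inner ℂ ((F - K) (K y)) y = -((‖K y‖ ^ 2 : ℝ) : ℂ) := by
      rw [_root_.sub_apply, inner_sub_left, h0, h1, zero_sub]
    have h3 : ‖K y‖ ^ 2 ≤ δ * ‖K y‖ * ‖y‖ := by
      have h4 := norm_inner_le_norm (𝕜 := ℂ) ((F - K) (K y)) y
      rw [h2, norm_neg, Complex.norm_real, Real.norm_of_nonneg (by positivity)] at h4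
      refine h4.trans ?_
      gcongr
      exact (F - K).le_of_opNorm_le hFK _
    have h5 : δ * ‖K y‖ * ‖y‖ = ‖K y‖ ^ 2 / 2 := by rw [hδ]; field_simp
    rw [h5] at h3
    nlinarith [sq_pos_of_pos hKy']
  · have := cfc_commute_cfc b (fun x => x) K
    rwa [cfc_id' ℝ K] at this
  · exact congrArg (fun A : H →L[ℂ] H => A (K y)) hKBF

/-! ### Test functions and Poincaré's inequality -/

section TestFunctions

variable {d : ℕ} {G : Set (EuclideanSpace ℝ (Fin d))}

theorem IsTestFunction.zero : IsTestFunction G (0 : EuclideanSpace ℝ (Fin d) → ℂ) :=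
  ⟨contDiff_const, HasCompactSupport.zero, by simp [tsupport]⟩

theorem IsTestFunction.add {ψ χ : EuclideanSpace ℝ (Fin d) → ℂ} (hψ : IsTestFunction G ψ)
    (hχ : IsTestFunction G χ) : IsTestFunction G (ψ + χ) :=
  ⟨hψ.1.add hχ.1, hψ.2.1.add hχ.2.1,
    (tsupport_add ψ χ).trans (union_subset hψ.2.2 hχ.2.2)⟩

theorem IsTestFunction.smul {ψ : EuclideanSpace ℝ (Fin d) → ℂ} (c : ℂ)
    (hψ : IsTestFunction G ψ) : IsTestFunction G (c • ψ) :=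
  ⟨contDiff_const.smul hψ.1, hψ.2.1.smul_left (f := fun _ => c),
    (closure_mono (Function.support_const_smul_subset c ψ)).trans hψ.2.2⟩

theorem IsTestFunction.continuous {ψ : EuclideanSpace ℝ (Fin d) → ℂ}
    (hψ : IsTestFunction G ψ) : Continuous ψ := hψ.1.continuous

theorem IsTestFunction.differentiable {ψ : EuclideanSpace ℝ (Fin d) → ℂ}
    (hψ : IsTestFunction G ψ) : Differentiable ℝ ψ := hψ.1.differentiable (by simp)

theorem IsTestFunction.continuous_partialDeriv {ψ : EuclideanSpace ℝ (Fin d) → ℂ}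
    (hψ : IsTestFunction G ψ) (i : Fin d) : Continuous (partialDeriv i ψ) :=
  (hψ.1.continuous_fderiv (by simp)).clm_apply continuous_const

theorem IsTestFunction.hasCompactSupport_partialDeriv {ψ : EuclideanSpace ℝ (Fin d) → ℂ}
    (hψ : IsTestFunction G ψ) (i : Fin d) : HasCompactSupport (partialDeriv i ψ) :=
  hψ.2.1.fderiv_apply ℝ _

theorem IsTestFunction.memLp {ψ : EuclideanSpace ℝ (Fin d) → ℂ} (hψ : IsTestFunction G ψ) :
    MemLp ψ 2 (volume.restrict G) :=
  (hψ.continuous.memLp_of_hasCompactSupport hψ.2.1).restrict G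

theorem IsTestFunction.memLp_partialDeriv {ψ : EuclideanSpace ℝ (Fin d) → ℂ}
    (hψ : IsTestFunction G ψ) (i : Fin d) : MemLp (partialDeriv i ψ) 2 (volume.restrict G) :=
  ((hψ.continuous_partialDeriv i).memLp_of_hasCompactSupport
    (hψ.hasCompactSupport_partialDeriv i)).restrict G

variable (G) in
/-- The complex vector space `C_c^∞(G)`. -/
def testFunctions : Submodule ℂ (EuclideanSpace ℝ (Fin d) → ℂ) where
  carrier := {ψ | IsTestFunction G ψ}
  zero_mem' := IsTestFunction.zero
  add_mem' := IsTestFunction.add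
  smul_mem' := fun c _ h => IsTestFunction.smul c h

variable (G) in
/-- The inclusion of the test functions into `L²(G)`. -/
noncomputable def testToL2 : testFunctions G →ₗ[ℂ] L2 G where
  toFun ψ := (IsTestFunction.memLp ψ.2).toLp ψ
  map_add' _ _ := rfl
  map_smul' _ _ := rfl

variable (G) in
/-- The gradient of test functions, with values in `L²(G)^d`. -/
noncomputable def testGradient : testFunctions G →ₗ[ℂ] PiLp 2 (fun _ : Fin d => L2 G) where
  toFun ψ := WithLp.toLp 2 fun i => (IsTestFunction.memLp_partialDeriv ψ.2 i).toLp _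
  map_add' ψ χ := by
    ext1 i
    simp only [PiLp.add_apply]
    rw [← MemLp.toLp_add]
    congr 1
    ext x
    simp only [partialDeriv, Submodule.coe_add, Pi.add_apply]
    rw [fderiv_add (IsTestFunction.differentiable ψ.2 x) (IsTestFunction.differentiable χ.2 x)]
    rfl
  map_smul' c ψ := by
    ext1 i
    simp only [PiLp.smul_apply, RingHom.id_apply]
    rw [← MemLp.toLp_const_smul]
    congr 1
    ext x
    simp only [partialDeriv, Submodule.coe_smul, Pi.smul_apply]
    rw [fderiv_const_smul (IsTestFunction.differentiable ψ.2 x)]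
    rfl

theorem norm_toLp_sq {X : Type*} [MeasurableSpace X] {μ : Measure X} {f : X → ℂ}
    (hf : MemLp f 2 μ) : ‖hf.toLp f‖ ^ 2 = ∫ x, ‖f x‖ ^ 2 ∂μ := by
  have h := L2.inner_def (𝕜 := ℂ) (hf.toLp f) (hf.toLp f)
  have h2 : ∫ x, inner ℂ (hf.toLp f x) (hf.toLp f x) ∂μ = ((∫ x, ‖f x‖ ^ 2 ∂μ : ℝ) : ℂ) := by
    rw [← integral_complex_ofReal]
    refine integral_congr_ae ?_
    filter_upwards [hf.coeFn_toLp] with x hx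
    rw [hx, inner_self_eq_norm_sq_to_K]
    norm_cast
  rw [h2, inner_self_eq_norm_sq_to_K] at h
  exact Complex.ofReal_injective (by rw [← h]; push_cast; rfl)

/-- Poincaré's inequality: a test function is controlled by any one of its partial derivatives. -/
theorem norm_testToL2_le (i : Fin d) {R : ℝ} (hR : 0 ≤ R) (hG : ∀ x ∈ G, |x i| ≤ R)
    (ψ : testFunctions G) : ‖testToL2 G ψ‖ ≤ 2 * R * ‖testGradient G ψ‖ := by
  obtain ⟨ψ, hψ⟩ := ψ
  change IsTestFunction G ψ at hψ
  have hc := hψ.continuous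
  have hs := hψ.2.1
  have hcd := hψ.continuous_partialDeriv i
  have hsd := hψ.hasCompactSupport_partialDeriv i
  set e : EuclideanSpace ℝ (Fin d) := EuclideanSpace.single i 1 with he
  have hsupp : ∀ x, x ∉ G → ψ x = 0 := fun x hx =>
    image_eq_zero_of_notMem_tsupport fun h => hx (hψ.2.2 h)
  have hsuppd : ∀ x, x ∉ G → partialDeriv i ψ x = 0 := fun x hx => by
    have : fderiv ℝ ψ x = 0 := by
      by_contra h
      exact hx (hψ.2.2 (support_fderiv_subset ℝ h))
    simp [partialDeriv, this]
  have hint : ∀ (f : EuclideanSpace ℝ (Fin d) → ℝ), Continuous f → (∀ x, ψ x = 0 → f x = 0) →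
      Integrable f := fun f hf h =>
    hf.integrable_of_hasCompactSupport (hs.mono fun x hx hx' => hx (h x hx'))
  have hn : ∀ x, HasFDerivAt (fun x => ‖ψ x‖ ^ 2)
      (2 • (innerSL ℝ (ψ x)).comp (fderiv ℝ ψ x)) x := fun x =>
    (hψ.differentiable x).hasFDerivAt.norm_sq
  let p : EuclideanSpace ℝ (Fin d) →L[ℝ] ℝ := EuclideanSpace.proj i
  have hI1 : Integrable fun x => ‖ψ x‖ ^ 2 :=
    hint _ (by fun_prop) fun x hx => by simp [hx]
  have hI2 : Integrable fun x => x i * (2 * inner ℝ (ψ x) (partialDeriv i ψ x)) :=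
    hint _ (by fun_prop) fun x hx => by simp [hx]
  have hI3 : Integrable fun x => ‖partialDeriv i ψ x‖ ^ 2 :=
    (by fun_prop : Continuous fun x => ‖partialDeriv i ψ x‖ ^ 2).integrable_of_hasCompactSupport
      (hsd.mono fun x hx hx' => hx (by simp [hx']))
  -- Integration by parts of `‖ψ‖ ^ 2` against the coordinate `x i`, whose derivative in direction
  -- `i` is `1`.
  have key : ∫ x, x i * (2 * inner ℝ (ψ x) (partialDeriv i ψ x)) = -∫ x, ‖ψ x‖ ^ 2 := by
    have := integral_bilinear_hasFDerivAt_right_eq_neg_left_of_integrable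
      (μ := (volume : Measure (EuclideanSpace ℝ (Fin d)))) (f := p) (f' := fun _ => p)
      (g := fun x => ‖ψ x‖ ^ 2) (g' := fun x => 2 • (innerSL ℝ (ψ x)).comp (fderiv ℝ ψ x))
      (v := e) (B := ContinuousLinearMap.mul ℝ ℝ) ?_ ?_ ?_ (fun x _ => p.hasFDerivAt)
      (fun x _ => hn x)
    · simpa [p, he, partialDeriv, mul_add] using this
    · simpa [p, he] using hI1
    · simpa [p, he, partialDeriv, mul_add] using hI2
    · exact hint _ (by fun_prop) fun x hx => by simp [hx]
  have hle : ∫ x, ‖ψ x‖ ^ 2 ≤ ∫ x, (1 / 2 * ‖ψ x‖ ^ 2 + 2 * R ^ 2 * ‖partialDeriv i ψ x‖ ^ 2) := by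
    rw [← neg_eq_iff_eq_neg.2 key, ← integral_neg]
    refine integral_mono hI2.neg ((hI1.const_mul _).add (hI3.const_mul _)) fun x => ?_
    change -(x i * (2 * inner ℝ (ψ x) (partialDeriv i ψ x))) ≤
      1 / 2 * ‖ψ x‖ ^ 2 + 2 * R ^ 2 * ‖partialDeriv i ψ x‖ ^ 2
    by_cases hx : x ∈ G
    · have h1 := abs_real_inner_le_norm (ψ x) (partialDeriv i ψ x)
      have h2 : |x i * (2 * inner ℝ (ψ x) (partialDeriv i ψ x))| ≤
          R * (2 * (‖ψ x‖ * ‖partialDeriv i ψ x‖)) := by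
        rw [abs_mul, abs_mul, abs_two]
        gcongr
        exact hG x hx
      have h3 := neg_abs_le (x i * (2 * inner ℝ (ψ x) (partialDeriv i ψ x)))
      nlinarith [sq_nonneg (‖ψ x‖ - 2 * (R * ‖partialDeriv i ψ x‖))]
    · simp [hsupp x hx, hsuppd x hx]
  rw [integral_add (hI1.const_mul _) (hI3.const_mul _), integral_const_mul,
    integral_const_mul] at hle
  have e1 : ‖testToL2 G ⟨ψ, hψ⟩‖ ^ 2 = ∫ x, ‖ψ x‖ ^ 2 := by
    change ‖hψ.memLp.toLp ψ‖ ^ 2 = _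
    rw [norm_toLp_sq]
    exact setIntegral_eq_integral_of_forall_compl_eq_zero fun x hx => by simp [hsupp x hx]
  have e2 : ‖testGradient G ⟨ψ, hψ⟩ i‖ ^ 2 = ∫ x, ‖partialDeriv i ψ x‖ ^ 2 := by
    change ‖(hψ.memLp_partialDeriv i).toLp _‖ ^ 2 = _
    rw [norm_toLp_sq]
    exact setIntegral_eq_integral_of_forall_compl_eq_zero fun x hx => by simp [hsuppd x hx]
  have e3 : ‖testGradient G ⟨ψ, hψ⟩ i‖ ≤ ‖testGradient G ⟨ψ, hψ⟩‖ := PiLp.norm_apply_le _ i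
  rw [← e1, ← e2] at hle
  have e4 : ‖testToL2 G ⟨ψ, hψ⟩‖ ≤ 2 * R * ‖testGradient G ⟨ψ, hψ⟩ i‖ := by
    refine le_of_sq_le_sq ?_ (by positivity)
    nlinarith
  exact e4.trans (by gcongr)

end TestFunctions

/-! ### The inverse Dirichlet Laplacian -/

section DirichletInverse

variable {d : ℕ} {G : Set (EuclideanSpace ℝ (Fin d))}

variable (G) in
/-- The closure in `L²(G)^d` of the space of gradients of test functions. -/
noncomputable def gradientSpace : Submodule ℂ (PiLp 2 (fun _ : Fin d => L2 G)) :=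
  (LinearMap.range (testGradient G)).topologicalClosure

noncomputable instance : CompleteSpace (gradientSpace G) :=
  (Submodule.isClosed_topologicalClosure _).completeSpace_coe

variable (G) in
/-- The gradient of test functions, with values in the closure of its range. -/
noncomputable def testGradientCod : testFunctions G →ₗ[ℂ] gradientSpace G :=
  (testGradient G).codRestrict _ fun ψ =>
    Submodule.le_topologicalClosure _ (LinearMap.mem_range_self _ ψ)

theorem denseRange_testGradientCod : DenseRange (testGradientCod G) := by
  rintro ⟨D, hD⟩
  rw [closure_subtype, ← range_comp]
  exact hD

variable (G) in
/-- The bounded operator which recovers an element of `H¹₀(G)` from its gradient. -/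
noncomputable def gradientInverse : gradientSpace G →L[ℂ] L2 G :=
  (testToL2 G).extendOfNorm (testGradientCod G)

variable (G) in
/-- The inverse of the negative Dirichlet Laplacian. -/
noncomputable def dirichletInverse : L2 G →L[ℂ] L2 G :=
  gradientInverse G ∘L ContinuousLinearMap.adjoint (gradientInverse G)

theorem isSelfAdjoint_dirichletInverse : IsSelfAdjoint (dirichletInverse G) := by
  rw [ContinuousLinearMap.isSelfAdjoint_iff_isSymmetric]
  intro f g
  exact (ContinuousLinearMap.adjoint_inner_right (gradientInverse G) _ _).symm.trans
    (ContinuousLinearMap.adjoint_inner_left (gradientInverse G) _ _)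

/-- Poincaré's inequality is what makes the extension by density meaningful; this is where `G`
bounded and `d ≥ 1` enter. -/
theorem gradientInverse_apply (hd : 1 ≤ d) (hG : Bornology.IsBounded G) (ψ : testFunctions G) :
    gradientInverse G (testGradientCod G ψ) = testToL2 G ψ := by
  obtain ⟨R, hR⟩ := hG.exists_norm_le
  refine LinearMap.extendOfNorm_eq denseRange_testGradientCod ⟨2 * max R 0, fun ψ => ?_⟩ ψ
  refine norm_testToL2_le ⟨0, hd⟩ (le_max_right _ _) (fun x hx => ?_) ψ
  exact (PiLp.norm_apply_le x _).trans ((hR x hx).trans (le_max_left _ _))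

theorem integral_mul_conj_testFunction (g : L2 G) (ψ : testFunctions G) :
    ∫ x in G, g x * conj ((ψ : EuclideanSpace ℝ (Fin d) → ℂ) x) = inner ℂ (testToL2 G ψ) g := by
  rw [L2.inner_def]
  refine integral_congr_ae ?_
  filter_upwards [(IsTestFunction.memLp ψ.2).coeFn_toLp] with x hx
  rw [RCLike.inner_apply]
  exact congrArg (fun z => g x * conj z) hx.symm

theorem integral_mul_conj_partialDeriv (g : L2 G) (ψ : testFunctions G) (i : Fin d) :
    ∫ x in G, g x * conj (partialDeriv i ψ x) = inner ℂ (testGradient G ψ i) g := by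
  rw [L2.inner_def]
  refine integral_congr_ae ?_
  filter_upwards [(IsTestFunction.memLp_partialDeriv ψ.2 i).coeFn_toLp] with x hx
  rw [RCLike.inner_apply]
  exact congrArg (fun z => g x * conj z) hx.symm

theorem eLpNorm_sub_toLp {X : Type*} [MeasurableSpace X] {μ : Measure X} (g : Lp ℂ 2 μ)
    {f : X → ℂ} (hf : MemLp f 2 μ) :
    eLpNorm (fun x => g x - f x) 2 μ = edist g (hf.toLp f) := by
  rw [Lp.edist_def]
  refine eLpNorm_congr_ae ?_
  filter_upwards [hf.coeFn_toLp] with x hx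
  simp [hx]

/-- With `J` the map from gradients to functions, `D = J* g` is the gradient of `J D = J J* g`, and
adjointness `⟨D, ∇ψ⟩ = ⟨g, J ∇ψ⟩ = ⟨g, ψ⟩` is exactly the weak form of `-Δ (J D) = g`. -/
theorem hasDirichletLaplacian_dirichletInverse (hd : 1 ≤ d) (hG : Bornology.IsBounded G)
    (g : L2 G) : HasDirichletLaplacian G (dirichletInverse G g) (-g) := by
  set D : gradientSpace G := ContinuousLinearMap.adjoint (gradientInverse G) g with hD
  refine ⟨fun i => (D : PiLp 2 (fun _ : Fin d => L2 G)) i, ?_, fun ψ hψ => ?_⟩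
  · obtain ⟨v, hv, hlim⟩ := mem_closure_iff_seq_limit.1 (denseRange_testGradientCod D)
    choose ψ hψ using hv
    have hlim' : Tendsto (fun k => testGradientCod G (ψ k)) atTop (𝓝 D) := by simpa only [hψ]
    refine ⟨fun k => ψ k, fun k => (ψ k).2, ?_, fun i => ?_⟩
    · simp_rw [fun k => eLpNorm_sub_toLp (dirichletInverse G g) (IsTestFunction.memLp (ψ k).2)]
      have h := ((gradientInverse G).continuous.tendsto D).comp hlim'
      simp only [Function.comp_def, gradientInverse_apply hd hG] at h
      have h2 := (tendsto_const_nhds (x := dirichletInverse G g)).edist h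
      rw [show gradientInverse G D = dirichletInverse G g from rfl, edist_self] at h2
      exact h2
    · simp_rw [fun k => eLpNorm_sub_toLp ((D : PiLp 2 (fun _ : Fin d => L2 G)) i)
        (IsTestFunction.memLp_partialDeriv (ψ k).2 i)]
      have h := (((PiLp.continuous_apply 2 (fun _ : Fin d => L2 G) i).comp
        continuous_subtype_val).tendsto D).comp hlim'
      have h2 := (tendsto_const_nhds (x := (D : PiLp 2 (fun _ : Fin d => L2 G)) i)).edist h
      simp only [Function.comp_def, edist_self] at h2
      exact h2
  · have h1 := integral_mul_conj_testFunction (-g) (⟨ψ, hψ⟩ : testFunctions G)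
    have h2 := fun i => integral_mul_conj_partialDeriv ((D : PiLp 2 (fun _ : Fin d => L2 G)) i)
      (⟨ψ, hψ⟩ : testFunctions G) i
    refine h1.trans ?_
    simp only at h2
    rw [inner_neg_right, neg_inj, Finset.sum_congr rfl fun i _ => h2 i,
      ← gradientInverse_apply hd hG, ← ContinuousLinearMap.adjoint_inner_right, ← hD,
      Submodule.coe_inner, PiLp.inner_apply]
    rfl

theorem eq_zero_of_inner_testFunctions (hG : IsOpen G) {g : L2 G}
    (h : ∀ ψ : testFunctions G, inner ℂ (testToL2 G ψ) g = 0) : g = 0 := by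
  rw [Lp.eq_zero_iff_ae_eq_zero]
  refine (ae_restrict_iff' hG.measurableSet).2 ?_
  refine hG.ae_eq_zero_of_integral_contDiff_smul_eq_zero ?_ fun ψ hψ hs hsupp => ?_
  · have h1 : LocallyIntegrable g (volume.restrict G) :=
      (Lp.memLp g).locallyIntegrable (by norm_num)
    intro x hx
    obtain ⟨U, hU, hUi⟩ := h1 x
    refine ⟨U ∩ G, inter_mem (mem_nhdsWithin_of_mem_nhds hU) self_mem_nhdsWithin, ?_⟩
    rw [IntegrableOn, ← Measure.restrict_restrict₀' hG.measurableSet.nullMeasurableSet]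
    exact hUi
  · have ht : IsTestFunction G fun x => (ψ x : ℂ) :=
      ⟨Complex.ofRealCLM.contDiff.comp hψ, hs.comp_left (g := fun r : ℝ => (r : ℂ)) (by simp),
        (closure_mono fun x (hx : (ψ x : ℂ) ≠ 0) (hx' : ψ x = 0) => hx (by simp [hx'])).trans hsupp⟩
    have h2 := h ⟨_, ht⟩
    rw [← integral_mul_conj_testFunction] at h2
    rw [← h2, ← setIntegral_eq_integral_of_forall_compl_eq_zero (s := G)]
    · refine integral_congr_ae (Eventually.of_forall fun x => ?_)
      simp [mul_comm]
    · intro x hx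
      rw [image_eq_zero_of_notMem_tsupport fun h => hx (hsupp h), zero_smul]

/-- If `J J* g = 0` then `‖J* g‖ ^ 2 = 0`, so `g` is orthogonal to the range of `J`, which contains
all test functions. -/
theorem injective_dirichletInverse (hd : 1 ≤ d) (hG : IsOpen G) (hGb : Bornology.IsBounded G) :
    Function.Injective (dirichletInverse G) := by
  refine (injective_iff_map_eq_zero _).2 fun g hg => eq_zero_of_inner_testFunctions hG fun ψ => ?_
  have h1 : ContinuousLinearMap.adjoint (gradientInverse G) g = 0 := by
    rw [← inner_self_eq_zero (𝕜 := ℂ), ContinuousLinearMap.adjoint_inner_right]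
    change inner ℂ (dirichletInverse G g) g = 0
    rw [hg, inner_zero_left]
  rw [← gradientInverse_apply hd hGb, ← ContinuousLinearMap.adjoint_inner_right, h1,
    inner_zero_right]

end DirichletInverse

/-! ### Fractional integrals of bounded functions -/

section FractionalIntegral

/-- `f` is measurable and bounded by `M` almost everywhere on `(0, T]`. -/
structure IsBddOn (T M : ℝ) (f : ℝ → ℂ) : Prop where
  aesm : AEStronglyMeasurable f (volume.restrict (Ioc 0 T))
  bdd : ∀ᵐ s : ℝ, s ∈ Ioc 0 T → ‖f s‖ ≤ M

theorem IsBddOn.mono {T M t : ℝ} {f : ℝ → ℂ} (hf : IsBddOn T M f) (ht : t ≤ T) :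
    IsBddOn t M f :=
  ⟨hf.aesm.mono_set (Ioc_subset_Ioc_right ht),
    hf.bdd.mono fun _ hs h => hs (Ioc_subset_Ioc_right ht h)⟩

theorem IsBddOn.add {T M N : ℝ} {f g : ℝ → ℂ} (hf : IsBddOn T M f) (hg : IsBddOn T N g) :
    IsBddOn T (M + N) fun s => f s + g s :=
  ⟨hf.aesm.add hg.aesm, by
    filter_upwards [hf.bdd, hg.bdd] with s h1 h2 hs
    exact (norm_add_le _ _).trans (add_le_add (h1 hs) (h2 hs))⟩

theorem IsBddOn.const_mul {T M : ℝ} {f : ℝ → ℂ} (hf : IsBddOn T M f) (c : ℂ) :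
    IsBddOn T (‖c‖ * M) fun s => c * f s :=
  ⟨hf.aesm.const_mul c, by
    filter_upwards [hf.bdd] with s h1 hs
    rw [norm_mul]
    exact mul_le_mul_of_nonneg_left (h1 hs) (norm_nonneg _)⟩

theorem isBddOn_const (T : ℝ) (c : ℂ) : IsBddOn T ‖c‖ fun _ => c :=
  ⟨aestronglyMeasurable_const, Eventually.of_forall fun _ _ => le_rfl⟩

theorem IsBddOn.congr {T M : ℝ} {f g : ℝ → ℂ} (hf : IsBddOn T M f)
    (h : ∀ s ∈ Ioc 0 T, f s = g s) : IsBddOn T M g :=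
  ⟨hf.aesm.congr ((ae_restrict_iff' measurableSet_Ioc).2 (Eventually.of_forall h)),
    hf.bdd.mono fun s h1 hs => h s hs ▸ h1 hs⟩

theorem _root_.ContinuousOn.isBddOn {T M : ℝ} {f : ℝ → ℂ} (hf : ContinuousOn f (Icc 0 T))
    (h : ∀ s ∈ Icc 0 T, ‖f s‖ ≤ M) : IsBddOn T M f :=
  ⟨(hf.mono Ioc_subset_Icc_self).aestronglyMeasurable measurableSet_Ioc,
    Eventually.of_forall fun s hs => h s (Ioc_subset_Icc_self hs)⟩

theorem intervalIntegrable_sub_rpow {β : ℝ} (hβ : 0 < β) (t a b : ℝ) :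
    IntervalIntegrable (fun s => (t - s) ^ (β - 1) / Real.Gamma β) volume a b := by
  have h := (intervalIntegral.intervalIntegrable_rpow' (a := t - a) (b := t - b)
    (by linarith : -1 < β - 1)).comp_sub_left t
  simp only [sub_sub_cancel] at h
  exact h.div_const _

theorem integral_sub_rpow {β : ℝ} (hβ : 0 < β) (t a b : ℝ) :
    ∫ s in a..b, (t - s) ^ (β - 1) / Real.Gamma β =
      ((t - a) ^ β - (t - b) ^ β) / Real.Gamma (β + 1) := by
  rw [intervalIntegral.integral_div,
    intervalIntegral.integral_comp_sub_left (fun x => x ^ (β - 1)) t,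
    integral_rpow (Or.inl (by linarith)), sub_add_cancel, Real.Gamma_add_one hβ.ne', div_div]

theorem IsBddOn.norm_mul_le {M t a b β : ℝ} {f : ℝ → ℂ} (hf : IsBddOn t M f) (hβ : 0 < β)
    (ha : 0 ≤ a) (hb : b ≤ t) :
    ∀ᵐ s : ℝ, s ∈ Ioc a b → ‖(((t - s) ^ (β - 1) / Real.Gamma β : ℝ) : ℂ) * f s‖ ≤
      M * ((t - s) ^ (β - 1) / Real.Gamma β) := by
  filter_upwards [hf.bdd] with s h hs
  have h0 : 0 ≤ (t - s) ^ (β - 1) / Real.Gamma β :=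
    div_nonneg (Real.rpow_nonneg (by linarith [hs.2]) _) (Real.Gamma_pos_of_pos hβ).le
  rw [norm_mul, Complex.norm_real, Real.norm_of_nonneg h0, mul_comm]
  exact mul_le_mul_of_nonneg_right (h ⟨by linarith [hs.1], by linarith [hs.2]⟩) h0

theorem IsBddOn.intervalIntegrable {M t β : ℝ} {f : ℝ → ℂ} (hf : IsBddOn t M f)
    (hβ : 0 < β) (ht : 0 ≤ t) (r : ℝ) :
    IntervalIntegrable (fun s => (((r - s) ^ (β - 1) / Real.Gamma β : ℝ) : ℂ) * f s)
      volume 0 t := by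
  rw [intervalIntegrable_iff_integrableOn_Ioc_of_le ht]
  have h := ((intervalIntegrable_iff_integrableOn_Ioc_of_le ht).1
    (intervalIntegrable_sub_rpow hβ r 0 t)).ofReal (𝕜 := ℂ)
  exact h.mul_bdd hf.aesm ((ae_restrict_iff' measurableSet_Ioc).2 hf.bdd)

theorem norm_fracIntegral_le {M t β : ℝ} {f : ℝ → ℂ} (hf : IsBddOn t M f) (hβ : 0 < β)
    (ht : 0 ≤ t) : ‖fracIntegral β f t‖ ≤ M * (t ^ β / Real.Gamma (β + 1)) := by
  refine (intervalIntegral.norm_integral_le_of_norm_le ht (hf.norm_mul_le hβ le_rfl le_rfl)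
    ((intervalIntegrable_sub_rpow hβ t 0 t).const_mul M)).trans_eq ?_
  rw [intervalIntegral.integral_const_mul, integral_sub_rpow hβ, sub_zero, sub_self,
    Real.zero_rpow hβ.ne', sub_zero]

theorem fracIntegral_const {t β : ℝ} (hβ : 0 < β) (c : ℂ) :
    fracIntegral β (fun _ => c) t = ((t ^ β / Real.Gamma (β + 1) : ℝ) : ℂ) * c := by
  rw [fracIntegral, intervalIntegral.integral_mul_const, intervalIntegral.integral_ofReal,
    integral_sub_rpow hβ, sub_zero, sub_self, Real.zero_rpow hβ.ne', sub_zero]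

theorem fracIntegral_add {M N t β : ℝ} {f g : ℝ → ℂ} (hf : IsBddOn t M f) (hg : IsBddOn t N g)
    (hβ : 0 < β) (ht : 0 ≤ t) :
    fracIntegral β (fun s => f s + g s) t = fracIntegral β f t + fracIntegral β g t := by
  simp only [fracIntegral, mul_add]
  exact intervalIntegral.integral_add (hf.intervalIntegrable hβ ht t)
    (hg.intervalIntegrable hβ ht t)

theorem fracIntegral_const_mul (β : ℝ) (c : ℂ) (f : ℝ → ℂ) (t : ℝ) :
    fracIntegral β (fun s => c * f s) t = c * fracIntegral β f t := by
  simp only [fracIntegral, mul_left_comm _ c]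
  exact intervalIntegral.integral_const_mul c _

theorem fracIntegral_congr {t β : ℝ} {f g : ℝ → ℂ} (ht : 0 ≤ t)
    (h : ∀ s ∈ Icc 0 t, f s = g s) : fracIntegral β f t = fracIntegral β g t := by
  refine intervalIntegral.integral_congr fun s hs => ?_
  rw [uIcc_of_le ht] at hs
  simp only [h s hs]

theorem fracIntegral_one (f : ℝ → ℂ) (t : ℝ) : fracIntegral 1 f t = ∫ s in (0 : ℝ)..t, f s := by
  simp [fracIntegral]

/-- Since `β < 1` the kernel decreases with the elapsed time, so the difference of the kernels on
`(0, t)` has constant sign and its integral is explicit. It and the integral over `(t, t')` each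
contribute at most `M (t' - t) ^ β / Γ(β + 1)`. -/
theorem norm_fracIntegral_sub_le {M t t' β : ℝ} {f : ℝ → ℂ} (hf : IsBddOn t' M f) (hβ : 0 < β)
    (hβ1 : β < 1) (ht : 0 ≤ t) (htt' : t ≤ t') (hM : 0 ≤ M) :
    ‖fracIntegral β f t' - fracIntegral β f t‖ ≤
      2 * M / Real.Gamma (β + 1) * (t' - t) ^ β := by
  have hΓ : 0 < Real.Gamma (β + 1) := Real.Gamma_pos_of_pos (by linarith)
  have hf' := hf.mono htt'
  have h1 := hf.intervalIntegrable hβ (ht.trans htt') t'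
  have h2 : IntervalIntegrable (fun s => (((t' - s) ^ (β - 1) / Real.Gamma β : ℝ) : ℂ) * f s)
      volume 0 t := h1.mono_set (by
    rw [uIcc_of_le ht, uIcc_of_le (ht.trans htt')]; exact Icc_subset_Icc_right htt')
  have h3 : IntervalIntegrable (fun s => (((t' - s) ^ (β - 1) / Real.Gamma β : ℝ) : ℂ) * f s)
      volume t t' := h1.mono_set (by
    rw [uIcc_of_le htt', uIcc_of_le (ht.trans htt')]; exact Icc_subset_Icc_left ht)
  have hsplit : fracIntegral β f t' - fracIntegral β f t =
      (∫ s in (0 : ℝ)..t, ((((t' - s) ^ (β - 1) / Real.Gamma β : ℝ) : ℂ) * f s -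
        (((t - s) ^ (β - 1) / Real.Gamma β : ℝ) : ℂ) * f s)) +
      ∫ s in t..t', (((t' - s) ^ (β - 1) / Real.Gamma β : ℝ) : ℂ) * f s := by
    rw [intervalIntegral.integral_sub h2 (hf'.intervalIntegrable hβ ht t), fracIntegral,
      fracIntegral, ← intervalIntegral.integral_add_adjacent_intervals h2 h3]
    ring
  have b2 : ‖∫ s in t..t', (((t' - s) ^ (β - 1) / Real.Gamma β : ℝ) : ℂ) * f s‖ ≤
      M * ((t' - t) ^ β / Real.Gamma (β + 1)) := by
    refine (intervalIntegral.norm_integral_le_of_norm_le htt' (hf.norm_mul_le hβ ht le_rfl)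
      ((intervalIntegrable_sub_rpow hβ t' t t').const_mul M)).trans_eq ?_
    rw [intervalIntegral.integral_const_mul, integral_sub_rpow hβ, sub_self,
      Real.zero_rpow hβ.ne', sub_zero]
  have b1 : ‖∫ s in (0 : ℝ)..t, ((((t' - s) ^ (β - 1) / Real.Gamma β : ℝ) : ℂ) * f s -
        (((t - s) ^ (β - 1) / Real.Gamma β : ℝ) : ℂ) * f s)‖ ≤
      M * ((t' - t) ^ β / Real.Gamma (β + 1)) := by
    refine (intervalIntegral.norm_integral_le_of_norm_le ht
      (g := fun s => M * ((t - s) ^ (β - 1) / Real.Gamma β - (t' - s) ^ (β - 1) / Real.Gamma β))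
      ?_ (((intervalIntegrable_sub_rpow hβ t 0 t).sub
        (intervalIntegrable_sub_rpow hβ t' 0 t)).const_mul M)).trans ?_
    -- At `s = t` the convention `0 ^ (β - 1) = 0` would break the monotonicity of the kernel.
    · have hne : ∀ᵐ s : ℝ, s ≠ t := by simp [ae_iff]
      filter_upwards [hf'.bdd, hne] with s hs hst hs'
      have hlt : s < t := lt_of_le_of_ne hs'.2 hst
      have hle : (t' - s) ^ (β - 1) / Real.Gamma β ≤ (t - s) ^ (β - 1) / Real.Gamma β := by
        refine div_le_div_of_nonneg_right ?_ (Real.Gamma_pos_of_pos hβ).le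
        exact Real.rpow_le_rpow_of_nonpos (by linarith) (by linarith) (by linarith)
      rw [← sub_mul, ← Complex.ofReal_sub, norm_mul, Complex.norm_real, Real.norm_eq_abs,
        abs_sub_comm, abs_of_nonneg (sub_nonneg.2 hle), mul_comm]
      exact mul_le_mul_of_nonneg_right (hs hs') (sub_nonneg.2 hle)
    · rw [intervalIntegral.integral_const_mul, intervalIntegral.integral_sub
        (intervalIntegrable_sub_rpow hβ t 0 t) (intervalIntegrable_sub_rpow hβ t' 0 t),
        integral_sub_rpow hβ, integral_sub_rpow hβ, sub_zero, sub_self,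
        Real.zero_rpow hβ.ne', sub_zero, ← sub_div]
      refine mul_le_mul_of_nonneg_left (div_le_div_of_nonneg_right ?_ hΓ.le) hM
      have : t ^ β ≤ t' ^ β := Real.rpow_le_rpow ht htt' hβ.le
      rw [sub_zero]
      linarith
  rw [hsplit]
  refine (norm_add_le _ _).trans ((add_le_add b1 b2).trans_eq ?_)
  ring

theorem continuousOn_fracIntegral {M T β : ℝ} {f : ℝ → ℂ} (hf : IsBddOn T M f) (hβ : 0 < β)
    (hβ1 : β < 1) (hM : 0 ≤ M) : ContinuousOn (fracIntegral β f) (Icc 0 T) := by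
  have key : ∀ t ∈ Icc 0 T, ∀ t' ∈ Icc 0 T, ‖fracIntegral β f t' - fracIntegral β f t‖ ≤
      2 * M / Real.Gamma (β + 1) * |t' - t| ^ β := by
    intro t ht t' ht'
    rcases le_total t t' with h | h
    · rw [abs_of_nonneg (sub_nonneg.2 h)]
      exact norm_fracIntegral_sub_le (hf.mono ht'.2) hβ hβ1 ht.1 h hM
    · rw [norm_sub_rev, abs_sub_comm, abs_of_nonneg (sub_nonneg.2 h)]
      exact norm_fracIntegral_sub_le (hf.mono ht.2) hβ hβ1 ht'.1 h hM
  intro t ht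
  have hlim : Tendsto (fun t' => 2 * M / Real.Gamma (β + 1) * |t' - t| ^ β) (𝓝[Icc 0 T] t)
      (𝓝 0) := by
    have hc : Continuous fun t' : ℝ => 2 * M / Real.Gamma (β + 1) * |t' - t| ^ β :=
      continuous_const.mul ((by fun_prop : Continuous fun t' : ℝ => |t' - t|).rpow_const
        fun _ => Or.inr hβ.le)
    have := hc.tendsto t
    simp only [sub_self, abs_zero, Real.zero_rpow hβ.ne', mul_zero] at this
    exact this.mono_left nhdsWithin_le_nhds
  refine tendsto_iff_norm_sub_tendsto_zero.2 (squeeze_zero' (Eventually.of_forall fun _ =>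
    norm_nonneg _) ?_ hlim)
  filter_upwards [self_mem_nhdsWithin] with t' ht'
  exact key t ht t' ht'

end FractionalIntegral

/-! ### Semigroup law and inversion of the Caputo derivative -/

section Semigroup

open scoped Convolution

/-- The kernel `x₊^(β - 1) / Γ(β)` of the fractional integral of order `β`. -/
noncomputable def fracKernel (β : ℝ) : ℝ → ℝ :=
  (Ioi 0).indicator fun x => x ^ (β - 1) / Real.Gamma β

theorem fracKernel_of_pos {x : ℝ} (β : ℝ) (hx : 0 < x) :
    fracKernel β x = x ^ (β - 1) / Real.Gamma β := indicator_of_mem (mem_Ioi.2 hx) _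

theorem fracKernel_of_nonpos {x : ℝ} (β : ℝ) (hx : x ≤ 0) : fracKernel β x = 0 :=
  indicator_of_notMem (notMem_Ioi.2 hx) _

theorem fracKernel_nonneg {β : ℝ} (hβ : 0 < β) (x : ℝ) : 0 ≤ fracKernel β x :=
  indicator_nonneg (fun _ hx => div_nonneg (Real.rpow_nonneg (le_of_lt hx) _)
    (Real.Gamma_pos_of_pos hβ).le) x

theorem measurable_fracKernel (β : ℝ) : Measurable (fracKernel β) :=
  Measurable.indicator (by fun_prop) measurableSet_Ioi

theorem integral_sub_rpow_mul_rpow {a b x : ℝ} (ha : 0 < a) (hb : 0 < b) (hx : 0 < x) :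
    ∫ s in (0 : ℝ)..x, s ^ (b - 1) * (x - s) ^ (a - 1) =
      x ^ (b + a - 1) * (Real.Gamma b * Real.Gamma a / Real.Gamma (b + a)) := by
  apply Complex.ofReal_injective
  have h := Complex.betaIntegral_scaled b a hx
  rw [Complex.betaIntegral_eq_Gamma_mul_div _ _ (by simpa) (by simpa), Complex.Gamma_ofReal,
    Complex.Gamma_ofReal, ← Complex.ofReal_add, Complex.Gamma_ofReal] at h
  rw [← intervalIntegral.integral_ofReal, Complex.ofReal_mul, Complex.ofReal_cpow hx.le]
  push_cast at h ⊢
  rw [← h]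
  refine intervalIntegral.integral_congr fun s hs => ?_
  rw [uIcc_of_le hx.le] at hs
  simp only [Complex.ofReal_cpow hs.1, Complex.ofReal_cpow (sub_nonneg.2 hs.2)]
  push_cast
  rfl

theorem integral_fracKernel_mul {a b : ℝ} (ha : 0 < a) (hb : 0 < b) (x : ℝ) :
    ∫ s, fracKernel b s * fracKernel a (x - s) = fracKernel (b + a) x := by
  have hΓa := (Real.Gamma_pos_of_pos ha).ne'
  have hΓb := (Real.Gamma_pos_of_pos hb).ne'
  have hz : ∀ s, s ∉ Ioo 0 x → fracKernel b s * fracKernel a (x - s) = 0 := by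
    intro s hs
    by_cases h : 0 < s
    · rw [fracKernel_of_nonpos a (sub_nonpos.2 (not_lt.1 fun h' => hs ⟨h, h'⟩)), mul_zero]
    · rw [fracKernel_of_nonpos b (not_lt.1 h), zero_mul]
  rcases le_or_gt x 0 with hx | hx
  · rw [fracKernel_of_nonpos _ hx]
    refine integral_eq_zero_of_ae (Eventually.of_forall fun s => hz s ?_)
    rw [Ioo_eq_empty (not_lt.2 hx)]
    exact notMem_empty s
  · rw [← setIntegral_eq_integral_of_forall_compl_eq_zero hz, fracKernel_of_pos _ hx]
    have h1 : ∫ s in Ioo 0 x, fracKernel b s * fracKernel a (x - s) =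
        ∫ s in Ioo 0 x, s ^ (b - 1) * (x - s) ^ (a - 1) / (Real.Gamma b * Real.Gamma a) := by
      refine setIntegral_congr_fun measurableSet_Ioo fun s hs => ?_
      rw [fracKernel_of_pos _ hs.1, fracKernel_of_pos _ (sub_pos.2 hs.2)]
      ring
    rw [h1, ← integral_Ioc_eq_integral_Ioo, ← intervalIntegral.integral_of_le hx.le,
      intervalIntegral.integral_div, integral_sub_rpow_mul_rpow ha hb hx]
    field_simp

theorem convolution_fracKernel {a b : ℝ} (ha : 0 < a) (hb : 0 < b) :
    (fracKernel b ⋆[ContinuousLinearMap.mul ℝ ℝ, volume] fracKernel a) = fracKernel (b + a) :=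
  funext fun x => integral_fracKernel_mul ha hb x

theorem convolutionExistsAt_fracKernel {a b : ℝ} (ha : 0 < a) (hb : 0 < b) (x : ℝ) :
    ConvolutionExistsAt (fracKernel b) (fracKernel a) x (ContinuousLinearMap.mul ℝ ℝ) volume := by
  rcases le_or_gt x 0 with hx | hx
  · refine (integrable_zero ℝ ℝ volume).congr (Eventually.of_forall fun s => ?_)
    simp only [ContinuousLinearMap.mul_apply']
    rcases le_or_gt s 0 with h | h
    · rw [fracKernel_of_nonpos b h, zero_mul, Pi.zero_apply]
    · rw [fracKernel_of_nonpos a (by linarith), mul_zero, Pi.zero_apply]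
  -- A non-integrable integrand would have integral `0`, whereas the Beta integral computed above is
  -- positive.
  · by_contra h
    have h1 := integral_undef h
    have h2 := integral_fracKernel_mul ha hb x
    simp only [ContinuousLinearMap.mul_apply'] at h1
    rw [h1, fracKernel_of_pos _ hx] at h2
    exact (div_pos (Real.rpow_pos_of_pos hx _)
      (Real.Gamma_pos_of_pos (add_pos hb ha))).ne h2

theorem integrableOn_fracKernel_sub {β : ℝ} (hβ : 0 < β) (x T : ℝ) (hT : 0 ≤ T) :
    IntegrableOn (fun s => fracKernel β (x - s)) (Ioc 0 T) := by
  have h := (intervalIntegrable_iff_integrableOn_Ioc_of_le hT).1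
    (intervalIntegrable_sub_rpow hβ x 0 T)
  exact h.indicator (measurableSet_Ioi.preimage (measurable_const.sub measurable_id) :
    MeasurableSet ((fun s => x - s) ⁻¹' Ioi 0))

/-- Scalar multiplication as a bilinear map `ℂ × ℝ → ℂ`. -/
noncomputable abbrev realSMulFlip : ℂ →L[ℝ] ℝ →L[ℝ] ℂ := (ContinuousLinearMap.lsmul ℝ ℝ).flip

theorem convolutionExistsAt_indicator {T M β : ℝ} {f : ℝ → ℂ} (hf : IsBddOn T M f) (hβ : 0 < β)
    (hT : 0 ≤ T) (x : ℝ) :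
    ConvolutionExistsAt ((Ioc 0 T).indicator f) (fracKernel β) x realSMulFlip volume := by
  have h : IntegrableOn (fun s => fracKernel β (x - s) • f s) (Ioc 0 T) :=
    (integrableOn_fracKernel_sub hβ x T hT).smul_bdd M hf.aesm
      ((ae_restrict_iff' measurableSet_Ioc).2 hf.bdd)
  refine (h.integrable_indicator measurableSet_Ioc).congr (Eventually.of_forall fun s => ?_)
  simp only [ContinuousLinearMap.flip_apply, ContinuousLinearMap.lsmul_apply]
  exact congrFun (indicator_smul (Ioc 0 T) (fun s => fracKernel β (x - s)) f) s

theorem convolution_fracKernel_eq_fracIntegral {β t : ℝ} {h : ℝ → ℂ} (ht : 0 ≤ t)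
    (hh : ∀ s ≤ 0, h s = 0) :
    (h ⋆[realSMulFlip, volume] fracKernel β) t = fracIntegral β h t := by
  have hz : ∀ s, s ∉ Ioo 0 t → realSMulFlip (h s) (fracKernel β (t - s)) = 0 := by
    intro s hs
    simp only [ContinuousLinearMap.flip_apply, ContinuousLinearMap.lsmul_apply]
    by_cases h0 : 0 < s
    · rw [fracKernel_of_nonpos β (sub_nonpos.2 (not_lt.1 fun h' => hs ⟨h0, h'⟩)), zero_smul]
    · rw [hh s (not_lt.1 h0), smul_zero]
  rw [convolution, ← setIntegral_eq_integral_of_forall_compl_eq_zero hz, fracIntegral,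
    intervalIntegral.integral_of_le ht, integral_Ioc_eq_integral_Ioo]
  refine setIntegral_congr_fun measurableSet_Ioo fun s hs => ?_
  simp only [ContinuousLinearMap.flip_apply, ContinuousLinearMap.lsmul_apply]
  rw [fracKernel_of_pos _ (sub_pos.2 hs.2), Complex.real_smul]

/-- The semigroup property of the fractional integrals. -/
theorem fracIntegral_fracIntegral {a b T M t : ℝ} {f : ℝ → ℂ} (hf : IsBddOn T M f) (ha : 0 < a)
    (hb : 0 < b) (ht : t ∈ Icc 0 T) :
    fracIntegral a (fracIntegral b f) t = fracIntegral (b + a) f t := by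
  have hT : 0 ≤ T := ht.1.trans ht.2
  -- The truncation lets the fractional integrals on `[0, T]` be read as convolutions on the line,
  -- so that the law becomes associativity of convolution together with the Beta integral.
  set F := (Ioc 0 T).indicator f with hF
  have hF0 : ∀ s ≤ 0, F s = 0 := fun s hs => indicator_of_notMem (fun h => hs.not_gt h.1) _
  have hFI : ∀ β : ℝ, ∀ r ∈ Icc 0 T, fracIntegral β F r = fracIntegral β f r := by
    intro β r hr
    simp only [fracIntegral, intervalIntegral.integral_of_le hr.1]
    refine setIntegral_congr_fun measurableSet_Ioc fun s hs => ?_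
    rw [hF, indicator_of_mem (Ioc_subset_Ioc_right hr.2 hs)]
  have hFm : AEStronglyMeasurable F volume :=
    (aestronglyMeasurable_indicator_iff measurableSet_Ioc).2 hf.aesm
  have hnorm : ∀ {β : ℝ}, 0 < β → (fun x => ‖fracKernel β x‖) = fracKernel β := fun hβ =>
    funext fun x => Real.norm_of_nonneg (fracKernel_nonneg hβ x)
  have hassoc := convolution_assoc (f := F) (g := fracKernel b) (k := fracKernel a)
    (μ := volume) (ν := volume) realSMulFlip realSMulFlip realSMulFlip
    (ContinuousLinearMap.mul ℝ ℝ) (x₀ := t) (fun x y z => by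
      simp only [ContinuousLinearMap.flip_apply, ContinuousLinearMap.lsmul_apply,
        ContinuousLinearMap.mul_apply', smul_smul, mul_comm]) hFm
    (measurable_fracKernel b).aestronglyMeasurable (measurable_fracKernel a).aestronglyMeasurable
    (Eventually.of_forall fun y => convolutionExistsAt_indicator hf hb hT y)
    (Eventually.of_forall fun x => by
      rw [hnorm ha, hnorm hb]; exact convolutionExistsAt_fracKernel ha hb x)
    (by
      rw [hnorm ha, hnorm hb, convolution_fracKernel ha hb]
      have h := (convolutionExistsAt_indicator hf (add_pos hb ha) hT t).norm
      refine h.congr (Eventually.of_forall fun s => ?_)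
      simp only [ContinuousLinearMap.flip_apply, ContinuousLinearMap.lsmul_apply,
        ContinuousLinearMap.mul_apply', norm_smul,
        Real.norm_of_nonneg (fracKernel_nonneg (add_pos hb ha) _)]
      exact mul_comm _ _)
  rw [convolution_fracKernel ha hb, convolution_fracKernel_eq_fracIntegral ht.1 hF0,
    convolution_fracKernel_eq_fracIntegral ht.1, hFI _ t ht] at hassoc
  · rw [← hassoc]
    refine fracIntegral_congr ht.1 fun s hs => ?_
    have hs' : s ∈ Icc 0 T := ⟨hs.1, hs.2.trans ht.2⟩
    rw [convolution_fracKernel_eq_fracIntegral hs.1 hF0, hFI _ s hs']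
  · intro s hs
    rw [convolution]
    refine integral_eq_zero_of_ae (Eventually.of_forall fun r => ?_)
    simp only [ContinuousLinearMap.flip_apply, ContinuousLinearMap.lsmul_apply, Pi.zero_apply]
    rcases le_or_gt r 0 with h | h
    · rw [hF0 r h, smul_zero]
    · rw [fracKernel_of_nonpos b (by linarith), zero_smul]

theorem eqOn_zero_of_integral_eq_zero {T : ℝ} {h : ℝ → ℂ} (hT : 0 < T)
    (hc : ContinuousOn h (Icc 0 T)) (h0 : ∀ t ∈ Icc 0 T, ∫ s in (0 : ℝ)..t, h s = 0) :
    ∀ t ∈ Icc 0 T, h t = 0 := by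
  have h1 : EqOn h (fun _ => 0) (Ioo 0 T) := by
    intro t ht
    have hd : HasDerivAt (fun t => ∫ s in (0 : ℝ)..t, h s) (h t) t :=
      intervalIntegral.integral_hasDerivAt_right
        ((hc.mono (by rw [uIcc_of_le ht.1.le]; exact Icc_subset_Icc_right ht.2.le)).intervalIntegrable)
        ((hc.mono Ioo_subset_Icc_self).stronglyMeasurableAtFilter isOpen_Ioo t ht)
        (hc.continuousAt (Icc_mem_nhds ht.1 ht.2))
    have hz : (fun t => ∫ s in (0 : ℝ)..t, h s) =ᶠ[𝓝 t] fun _ => 0 := by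
      filter_upwards [Icc_mem_nhds ht.1 ht.2] with s hs using h0 s hs
    exact hd.unique ((hasDerivAt_const t (0 : ℂ)).congr_of_eventuallyEq hz)
  exact h1.of_subset_closure hc continuousOn_const Ioo_subset_Icc_self
    (by rw [closure_Ioo hT.ne])

/-- If `g` is continuous with bounded Caputo derivative `f` of order `α`, then `g` is recovered
from `f` by the fractional integral of order `α`. -/
theorem HasCaputoDeriv.sub_eq_fracIntegral {α T M : ℝ} {g f : ℝ → ℂ}
    (h : HasCaputoDeriv α T g f) (hα0 : 0 < α) (hα1 : α < 1) (hT : 0 < T) (hM : 0 ≤ M)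
    (hg : ContinuousOn g (Icc 0 T)) (hf : IsBddOn T M f) :
    ∀ t ∈ Icc 0 T, g t - g 0 = fracIntegral α f t := by
  have hc := continuousOn_fracIntegral hf hα0 hα1 hM
  have hgc : ContinuousOn (fun s => g s - g 0) (Icc 0 T) := hg.sub continuousOn_const
  obtain ⟨N, hN⟩ := isCompact_Icc.exists_bound_of_continuousOn hgc
  have hgb : IsBddOn T N fun s => g s - g 0 := hgc.isBddOn hN
  -- Applying `I^α` to `I^(1-α) (g - g(0)) = I^1 f` gives `I^1 (g - g(0)) = I^1 (I^α f)`. Both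
  -- integrands are continuous, so the primitives can be differentiated.
  have hz := eqOn_zero_of_integral_eq_zero hT (hgc.sub hc) fun t ht => by
    have hsub : uIcc 0 t ⊆ Icc 0 T := by
      rw [uIcc_of_le ht.1]; exact Icc_subset_Icc_right ht.2
    have h1 := fracIntegral_fracIntegral hgb hα0 (sub_pos.2 hα1) ht
    rw [fracIntegral_congr ht.1 fun s hs => h.2 s ⟨hs.1, hs.2.trans ht.2⟩, sub_add_cancel,
      fracIntegral_one] at h1
    simp only [← fracIntegral_one] at h1
    rw [fracIntegral_fracIntegral hf hα0 one_pos ht, add_comm,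
      ← fracIntegral_fracIntegral hf one_pos hα0 ht, fracIntegral_one, fracIntegral_one] at h1
    rw [Pi.sub_def, intervalIntegral.integral_sub (hgc.mono hsub).intervalIntegrable
      (hc.mono hsub).intervalIntegrable, h1, sub_self]
  intro t ht
  exact sub_eq_zero.1 (hz t ht)

end Semigroup

/-! ### Growth of the Gamma function -/

section GammaGrowth

/-- Keep only the part `y > B` of the Gamma integral, where `y ^ x ≥ B ^ x`. As `B` is free, Gamma
beats every geometric sequence. -/
theorem exp_neg_mul_rpow_le_Gamma {x B : ℝ} (hx : 0 ≤ x) (hB : 0 ≤ B) :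
    Real.exp (-B) * B ^ x ≤ Real.Gamma (x + 1) := by
  rw [Real.Gamma_eq_integral (by linarith), add_sub_cancel_right, ← integral_exp_neg_Ioi,
    ← integral_mul_const]
  have hint : IntegrableOn (fun y => Real.exp (-y) * y ^ x) (Ioi 0) := by
    simpa using Real.GammaIntegral_convergent (s := x + 1) (by linarith)
  have hsub : Ioi B ⊆ Ioi (0 : ℝ) := Ioi_subset_Ioi hB
  calc ∫ y in Ioi B, Real.exp (-y) * B ^ x ≤ ∫ y in Ioi B, Real.exp (-y) * y ^ x := by
        refine setIntegral_mono_on ((integrableOn_exp_neg_Ioi B).mul_const _)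
          (hint.mono_set hsub) measurableSet_Ioi fun y hy => ?_
        exact mul_le_mul_of_nonneg_left (Real.rpow_le_rpow hB (le_of_lt hy) hx)
          (Real.exp_pos _).le
    _ ≤ ∫ y in Ioi 0, Real.exp (-y) * y ^ x := by
        refine setIntegral_mono_set hint ?_ (Eventually.of_forall hsub)
        refine (ae_restrict_iff' measurableSet_Ioi).2 (Eventually.of_forall fun y hy => ?_)
        exact mul_nonneg (Real.exp_pos _).le (Real.rpow_nonneg (le_of_lt hy) _)

/-- The Mittag-Leffler series has infinite radius of convergence. -/
theorem summable_pow_mul_rpow_div_Gamma {α T : ℝ} (hα : 0 < α) (hT : 0 < T) {q : ℝ}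
    (hq : 0 ≤ q) :
    Summable fun k : ℕ => q ^ k * (T ^ (α * k) / Real.Gamma (α * k + 1)) := by
  set r : ℝ := q * T ^ α with hr
  have hr0 : 0 ≤ r := mul_nonneg hq (Real.rpow_nonneg hT.le _)
  -- Makes `B ^ (α * k) = (2 * r + 1) ^ k`, so the terms are dominated by a geometric series of
  -- ratio `r / (2 * r + 1) < 1`.
  set B : ℝ := (2 * r + 1) ^ α⁻¹ with hB
  have hB0 : 0 < B := Real.rpow_pos_of_pos (by linarith) _
  have hBα : B ^ α = 2 * r + 1 := Real.rpow_inv_rpow (by linarith) hα.ne'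
  have hsum : Summable fun k : ℕ => Real.exp B * (r / (2 * r + 1)) ^ k :=
    (summable_geometric_of_lt_one (by positivity)
      ((div_lt_one (by linarith)).2 (by linarith))).mul_left _
  refine Summable.of_nonneg_of_le (fun k => ?_) (fun k => ?_) hsum
  · have := Real.Gamma_pos_of_pos (by positivity : 0 < α * k + 1)
    positivity
  · have hG := exp_neg_mul_rpow_le_Gamma (x := α * k) (by positivity) hB0.le
    have hG0 : 0 < Real.exp (-B) * B ^ (α * k) := by positivity
    have e1 : q ^ k * T ^ (α * k) = r ^ k := by
      rw [hr, mul_pow, Real.rpow_mul hT.le, Real.rpow_natCast]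
    have e2 : B ^ (α * k) = (2 * r + 1) ^ k := by
      rw [Real.rpow_mul hB0.le, hBα, Real.rpow_natCast]
    calc q ^ k * (T ^ (α * k) / Real.Gamma (α * k + 1)) = r ^ k / Real.Gamma (α * k + 1) := by
          rw [← mul_div_assoc, e1]
      _ ≤ r ^ k / (Real.exp (-B) * B ^ (α * k)) :=
          div_le_div_of_nonneg_left (by positivity) hG0 hG
      _ = Real.exp B * (r / (2 * r + 1)) ^ k := by
          rw [e2, Real.exp_neg, div_pow]
          field_simp

/-- Log-convexity of Gamma at `x + 1`, between `x + α` and `x + α + 1`, gives `x Γ(x) ≤ (x + α) ^ (1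
- α) Γ(x + α)`, hence a bound `2 x ^ (-α)` on the quotient for `x ≥ 1`. -/
theorem tendsto_Gamma_div_Gamma_add {α : ℝ} (hα0 : 0 < α) (hα1 : α < 1) :
    Tendsto (fun x => Real.Gamma x / Real.Gamma (x + α)) atTop (𝓝 0) := by
  have hle : ∀ x : ℝ, 1 ≤ x → Real.Gamma x / Real.Gamma (x + α) ≤ 2 * x ^ (-α) := by
    intro x hx
    have hx0 : 0 < x := by linarith
    have hG : 0 < Real.Gamma (x + α) := Real.Gamma_pos_of_pos (by linarith)
    have h := Real.Gamma_mul_add_mul_le_rpow_Gamma_mul_rpow_Gamma (s := x + α) (t := x + α + 1)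
      (a := α) (b := 1 - α) (by linarith) (by linarith) hα0 (by linarith) (by ring)
    rw [show α * (x + α) + (1 - α) * (x + α + 1) = x + 1 by ring, Real.Gamma_add_one hx0.ne',
      Real.Gamma_add_one (by linarith : 0 < x + α).ne', Real.mul_rpow (by linarith) hG.le, mul_left_comm,
      ← Real.rpow_add hG, add_sub_cancel, Real.rpow_one] at h
    have h2 : (x + α) ^ (1 - α) ≤ 2 * x ^ (1 - α) := by
      calc (x + α) ^ (1 - α) ≤ (2 * x) ^ (1 - α) :=
            Real.rpow_le_rpow (by linarith) (by linarith) (by linarith)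
        _ = 2 ^ (1 - α) * x ^ (1 - α) := Real.mul_rpow (by norm_num) hx0.le
        _ ≤ 2 ^ (1 : ℝ) * x ^ (1 - α) := by
            refine mul_le_mul_of_nonneg_right ?_ (by positivity)
            exact Real.rpow_le_rpow_of_exponent_le (by norm_num) (by linarith)
        _ = 2 * x ^ (1 - α) := by rw [Real.rpow_one]
    have h3 : x ^ (1 - α) = x * x ^ (-α) := by
      rw [sub_eq_add_neg, Real.rpow_add hx0, Real.rpow_one]
    rw [div_le_iff₀ hG]
    have h4 : x * Real.Gamma x ≤ x * (2 * x ^ (-α) * Real.Gamma (x + α)) := by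
      refine h.trans ((mul_le_mul_of_nonneg_right h2 hG.le).trans_eq ?_)
      rw [h3]; ring
    exact le_of_mul_le_mul_left h4 hx0
  have hlim : Tendsto (fun x : ℝ => 2 * x ^ (-α)) atTop (𝓝 0) := by
    simpa using (tendsto_rpow_neg_atTop hα0).const_mul 2
  refine tendsto_of_tendsto_of_tendsto_of_le_of_le' tendsto_const_nhds hlim ?_ ?_
  · filter_upwards [eventually_gt_atTop 0] with x hx
    exact div_nonneg (Real.Gamma_pos_of_pos hx).le (Real.Gamma_pos_of_pos (by linarith)).le
  · filter_upwards [eventually_ge_atTop 1] with x hx using hle x hx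

end GammaGrowth

/-! ### Zeros of entire functions -/

/-- The zeros of a power series with infinite radius of convergence form a countable set, unless
all its coefficients vanish. -/
theorem countable_zeros_of_summable {c : ℕ → ℂ}
    (hc : ∀ r : ℝ, 0 ≤ r → Summable fun k => ‖c k‖ * r ^ k) {p : ℕ} (hp : c p ≠ 0) : {z : ℂ | HasSum (fun k => z ^ k * c k) 0}.Countable := by
  set P := FormalMultilinearSeries.ofScalars ℂ c with hP
  have hrad : P.radius = ⊤ := ENNReal.eq_top_of_forall_nnreal_le fun r =>
    P.le_radius_of_summable (by simpa [hP] using hc r r.2)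
  have hball : HasFPowerSeriesOnBall P.sum P 0 ⊤ := by
    have := P.hasFPowerSeriesOnBall (by rw [hrad]; exact ENNReal.coe_lt_top)
    rwa [hrad] at this
  have han : AnalyticOnNhd ℂ P.sum univ := by
    have := hball.analyticOnNhd
    rwa [Metric.eball_top] at this
  have hzero : {z : ℂ | HasSum (fun k => z ^ k * c k) 0} ⊆ {z | P.sum z = 0} := by
    intro z hz
    have h1 : P.sum z = ∑' k, z ^ k * c k := by
      simp [hP, FormalMultilinearSeries.sum, mul_comm]
    rw [mem_ofPred_eq, h1, hz.tsum_eq]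
  refine Countable.mono hzero ?_
  -- By the identity theorem the zero set is discrete unless the sum vanishes identically, and
  -- discrete subsets of `ℂ` are countable.
  refine (HereditarilyLindelofSpace.isLindelof _).countable_of_isDiscrete ?_
  rcases han.eqOn_zero_or_eventually_ne_zero_of_preconnected isPreconnected_univ with h | h
  · have h0 : P = 0 := hball.hasFPowerSeriesAt.eq_zero_of_eventually
      (Eventually.of_forall fun w => h (mem_univ w))
    exact absurd ((FormalMultilinearSeries.ofScalars_eq_zero ℂ p).1 (by rw [← hP, h0]; rfl)) hp
  · have := isDiscrete_of_codiscreteWithin (s := {z | P.sum z = 0}) h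
    rwa [inter_univ] at this

/-! ### Power series expansion along a chain -/

section Chain

variable {α T : ℝ}

/-- The coefficients of the Mittag-Leffler type expansion of the value at time `T` of the solution
of `∂ₜ^α Y k = z Y (k + 1) + v k`, with `a k` the initial value of `Y k`. -/
noncomputable def chainCoeff (α T : ℝ) (a : ℕ → ℂ) (v : ℕ → ℝ → ℂ) (k : ℕ) : ℂ :=
  ((T ^ (α * k) / Real.Gamma (α * k + 1) : ℝ) : ℂ) * a k + fracIntegral (α + α * k) (v k) T

theorem norm_chainCoeff_le (hα : 0 < α) (hT : 0 < T) {a : ℕ → ℂ} {v : ℕ → ℝ → ℂ} {C N R : ℝ}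
    (ha : ∀ k, ‖a k‖ ≤ C * R ^ k) (hv : ∀ k, IsBddOn T (N * R ^ k) (v k)) (k : ℕ) :
    ‖chainCoeff α T a v k‖ ≤ C * (R ^ k * (T ^ (α * k) / Real.Gamma (α * k + 1))) +
      N * (R ^ k * (T ^ (α * (k + 1 : ℕ)) / Real.Gamma (α * (k + 1 : ℕ) + 1))) := by
  have hG : 0 < Real.Gamma (α * k + 1) := Real.Gamma_pos_of_pos (by positivity)
  refine (norm_add_le _ _).trans (add_le_add ?_ ?_)
  · rw [norm_mul, Complex.norm_real, Real.norm_of_nonneg (by positivity), mul_comm, ← mul_assoc]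
    exact mul_le_mul_of_nonneg_right (ha k) (by positivity)
  · have h := norm_fracIntegral_le (hv k) (by positivity : 0 < α + α * k) hT.le
    rw [mul_assoc] at h
    have e : α + α * k = α * (k + 1 : ℕ) := by push_cast; ring
    rwa [e] at h ⊢

theorem summable_chainCoeff (hα : 0 < α) (hT : 0 < T) {a : ℕ → ℂ} {v : ℕ → ℝ → ℂ} {C N R : ℝ}
    (hR : 0 < R) (ha : ∀ k, ‖a k‖ ≤ C * R ^ k) (hv : ∀ k, IsBddOn T (N * R ^ k) (v k))
    (r : ℝ) (hr : 0 ≤ r) : Summable fun k => ‖chainCoeff α T a v k‖ * r ^ k := by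
  have hq : ∀ q : ℝ, 0 < q → Summable fun k : ℕ =>
      C * (q ^ k * (T ^ (α * k) / Real.Gamma (α * k + 1))) +
      N * (q ^ k * (T ^ (α * (k + 1 : ℕ)) / Real.Gamma (α * (k + 1 : ℕ) + 1))) := by
    intro q hq
    have h1 := summable_pow_mul_rpow_div_Gamma hα hT hq.le
    have h2 := ((summable_nat_add_iff 1).2 h1).mul_left q⁻¹
    refine (h1.mul_left C).add (Summable.mul_left N (h2.congr fun k => ?_))
    rw [pow_succ]
    field_simp
  -- The index shift in the control term divides by `q`; `r + 1` in place of `r` keeps it nonzero.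
  have hs := hq (R * (r + 1)) (by positivity)
  refine Summable.of_nonneg_of_le (fun k => by positivity) (fun k => ?_) hs
  have h := norm_chainCoeff_le hα hT ha hv k
  have h1 : r ^ k ≤ (r + 1) ^ k := pow_le_pow_left₀ hr (by linarith) k
  calc ‖chainCoeff α T a v k‖ * r ^ k ≤ ‖chainCoeff α T a v k‖ * (r + 1) ^ k := by gcongr
    _ ≤ _ := mul_le_mul_of_nonneg_right h (by positivity)
    _ = _ := by rw [mul_pow]; ring

/-- Picard iteration: the equation for `Y m` is inserted into the remainder `I^(αm) (Y m)` and the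
semigroup law raises the order by `α`. The iteration starts at order `α`, since `fracIntegral 0` is
not the identity. -/
theorem eq_sum_chainCoeff_add (hα : 0 < α) (hT : 0 < T) {Y v : ℕ → ℝ → ℂ} {z : ℂ} {C N : ℕ → ℝ}
    (hY : ∀ k, IsBddOn T (C k) (Y k)) (hv : ∀ k, IsBddOn T (N k) (v k))
    (h : ∀ k, ∀ t ∈ Icc 0 T, Y k t - Y k 0 = fracIntegral α (fun s => z * Y (k + 1) s + v k s) t)
    (n : ℕ) :
    Y 0 T = ∑ k ∈ Finset.range (n + 1), z ^ k * chainCoeff α T (fun k => Y k 0) v k +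
      z ^ (n + 1) * fracIntegral (α * (n + 1 : ℕ)) (Y (n + 1)) T := by
  have hTT : T ∈ Icc 0 T := ⟨hT.le, le_rfl⟩
  have hsplit : ∀ k, ∀ β : ℝ, 0 < β → fracIntegral β (fun s => z * Y (k + 1) s + v k s) T =
      z * fracIntegral β (Y (k + 1)) T + fracIntegral β (v k) T := by
    intro k β hβ
    rw [fracIntegral_add ((hY (k + 1)).const_mul z) (hv k) hβ hT.le, fracIntegral_const_mul]
  induction n with
  | zero =>
    have h0 := h 0 T hTT
    rw [hsplit 0 α hα] at h0
    rw [sub_eq_iff_eq_add.1 h0]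
    simp [chainCoeff]
    ring
  | succ n ih =>
    rw [Finset.sum_range_succ, ih, add_assoc]
    congr 1
    set m := n + 1
    have hm : 0 < α * (m : ℝ) := by positivity
    have hF : IsBddOn T (‖z‖ * C (m + 1) + N m) fun s => z * Y (m + 1) s + v m s :=
      ((hY (m + 1)).const_mul z).add (hv m)
    have hIF : IsBddOn T (C m + ‖-Y m 0‖)
        (fracIntegral α fun s => z * Y (m + 1) s + v m s) :=
      ((hY m).add (isBddOn_const T (-Y m 0))).congr fun s hs => by
        rw [← h m s (Ioc_subset_Icc_self hs), sub_eq_add_neg]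
    have h1 : fracIntegral (α * m) (Y m) T = fracIntegral (α * m)
        (fun s => Y m 0 + fracIntegral α (fun s => z * Y (m + 1) s + v m s) s) T :=
      fracIntegral_congr hT.le fun s hs => by rw [← h m s hs]; ring
    rw [h1, fracIntegral_add (isBddOn_const T _) hIF hm hT.le, fracIntegral_const hm,
      fracIntegral_fracIntegral hF hm hα hTT, hsplit m _ (by positivity), chainCoeff]
    have e : α + α * (m : ℝ) = α * ((m + 1 : ℕ) : ℝ) := by push_cast; ring
    rw [e]
    ring

/-- The remainder is bounded by a term of the Mittag-Leffler series at `‖z‖ * R`, so geometric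
growth along the chain is harmless for every `z`. -/
theorem hasSum_chainCoeff (hα : 0 < α) (hT : 0 < T) {Y v : ℕ → ℝ → ℂ} {z : ℂ} {C N R : ℝ}
    (hR : 0 < R) (hY : ∀ k, IsBddOn T (C * R ^ k) (Y k)) (hY0 : ∀ k, ‖Y k 0‖ ≤ C * R ^ k)
    (hv : ∀ k, IsBddOn T (N * R ^ k) (v k))
    (h : ∀ k, ∀ t ∈ Icc 0 T,
      Y k t - Y k 0 = fracIntegral α (fun s => z * Y (k + 1) s + v k s) t) :
    HasSum (fun k => z ^ k * chainCoeff α T (fun k => Y k 0) v k) (Y 0 T) := by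
  have hsum : Summable fun k => z ^ k * chainCoeff α T (fun k => Y k 0) v k := by
    refine Summable.of_norm ((summable_chainCoeff hα hT hR hY0 hv ‖z‖ (norm_nonneg _)).congr ?_)
    intro k
    rw [norm_mul, norm_pow, mul_comm]
  have hrem : Tendsto (fun n : ℕ => z ^ (n + 1) *
      fracIntegral (α * (n + 1 : ℕ)) (Y (n + 1)) T) atTop (𝓝 0) := by
    have h0 := ((summable_pow_mul_rpow_div_Gamma hα hT
      (by positivity : 0 ≤ ‖z‖ * R)).tendsto_atTop_zero.comp (tendsto_add_atTop_nat 1)).const_mul C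
    rw [mul_zero] at h0
    refine squeeze_zero_norm (fun n => ?_) h0
    have hb := norm_fracIntegral_le (hY (n + 1)) (by positivity : 0 < α * ((n + 1 : ℕ) : ℝ)) hT.le
    rw [norm_mul, norm_pow]
    refine (mul_le_mul_of_nonneg_left hb (by positivity)).trans_eq ?_
    simp only [Function.comp_apply, mul_pow]
    ring
  have hlim : Tendsto (fun n : ℕ => ∑ k ∈ Finset.range (n + 1),
      z ^ k * chainCoeff α T (fun k => Y k 0) v k) atTop (𝓝 (Y 0 T)) := by
    have := (tendsto_const_nhds (x := Y 0 T)).sub hrem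
    rw [sub_zero] at this
    refine this.congr fun n => ?_
    rw [sub_eq_iff_eq_add]
    exact eq_sum_chainCoeff_add hα hT hY hv h n
  have := hsum.hasSum.tendsto_sum_nat.comp (tendsto_add_atTop_nat 1)
  exact (tendsto_nhds_unique this hlim) ▸ hsum.hasSum

end Chain

/-! ### Pairing with the control and with weak solutions -/

section Control

variable {d : ℕ} {G G₀ : Set (EuclideanSpace ℝ (Fin d))} {T : ℝ}
  {u : ℝ × EuclideanSpace ℝ (Fin d) → ℂ}

/-- The pairing of a bounded control with an element of `L²(G)` is a bounded function of time. -/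
theorem exists_isBddOn_integral_mul_conj (hGb : Bornology.IsBounded G)
    (hG₀G : G₀ ⊆ G)
    (hu : MemLp u ∞ (volume.restrict (Ioo (0 : ℝ) T ×ˢ G₀))) :
    ∃ N : ℝ, 0 ≤ N ∧ ∀ φ : L2 G, IsBddOn T (N * ‖φ‖) fun t => ∫ x in G₀, u (t, x) * conj (φ x) := by
  have : IsFiniteMeasure (volume.restrict G) := ⟨by simpa using hGb.measure_lt_top⟩
  -- The bound is `‖u‖_∞ ‖φ‖_{L¹(G)}`, and Cauchy–Schwarz on the finite measure space `G` supplies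
  -- `K = |G| ^ (1/2)`.
  set U : ℝ := (eLpNorm u ∞ (volume.restrict (Ioo (0 : ℝ) T ×ˢ G₀))).toReal with hU
  set K : ℝ := ((volume.restrict G) univ ^ ((1 : ℝ) - 1 / 2)).toReal with hK
  have hres : volume.restrict (Ioo (0 : ℝ) T ×ˢ G₀) =
      (volume.restrict (Ioc 0 T)).prod (volume.restrict G₀) := by
    rw [Measure.volume_eq_prod, ← Measure.prod_restrict, Measure.restrict_congr_set Ioo_ae_eq_Ioc]
  have hub : ∀ᵐ q ∂volume.restrict (Ioo (0 : ℝ) T ×ˢ G₀), ‖u q‖ ≤ U := by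
    filter_upwards [ae_le_eLpNormEssSup (f := u)
      (μ := volume.restrict (Ioo (0 : ℝ) T ×ˢ G₀))] with q hq
    have h := ENNReal.toReal_mono hu.2.ne (hq.trans_eq eLpNorm_exponent_top.symm)
    rwa [toReal_enorm] at h
  have hu1 := hu.1
  rw [hres] at hub hu1
  refine ⟨U * K, mul_nonneg ENNReal.toReal_nonneg ENNReal.toReal_nonneg, fun φ => ⟨?_, ?_⟩⟩
  · have hφ : AEStronglyMeasurable φ (volume.restrict G₀) :=
      (Lp.aestronglyMeasurable φ).mono_set hG₀G
    exact (hu1.mul (RCLike.continuous_conj.comp_aestronglyMeasurable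
      hφ.comp_snd)).integral_prod_right'
  · have hφi : IntegrableOn (fun x => ‖φ x‖) G :=
      ((Lp.memLp φ).integrable (by norm_num)).norm
    have hφ1 : ∫ x in G, ‖φ x‖ ≤ K * ‖φ‖ := by
      have h := eLpNorm_le_eLpNorm_mul_rpow_measure_univ (μ := volume.restrict G)
        (p := 1) (q := 2) (by norm_num) (Lp.aestronglyMeasurable φ)
      have h2 := ENNReal.toReal_mono (ENNReal.mul_ne_top (Lp.eLpNorm_ne_top φ)
        (ENNReal.rpow_ne_top_of_nonneg (by norm_num) (measure_ne_top _ _))) h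
      rw [ENNReal.toReal_mul, ← Lp.norm_def, eLpNorm_one_eq_lintegral_enorm,
        ← integral_norm_eq_lintegral_enorm (Lp.aestronglyMeasurable φ), mul_comm] at h2
      simpa [hK] using h2
    refine ((ae_restrict_iff' measurableSet_Ioc).1
      ((Measure.ae_ae_of_ae_prod hub).mono fun t ht => ?_))
    calc ‖∫ x in G₀, u (t, x) * conj (φ x)‖ ≤ ∫ x in G₀, U * ‖φ x‖ := by
          refine norm_integral_le_of_norm_le ((hφi.mono_set hG₀G).const_mul U) ?_
          filter_upwards [ht] with x hx
          rw [norm_mul, RCLike.norm_conj]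
          gcongr
      _ = U * ∫ x in G₀, ‖φ x‖ := integral_const_mul _ _
      _ ≤ U * ∫ x in G, ‖φ x‖ := by
          refine mul_le_mul_of_nonneg_left ?_ ENNReal.toReal_nonneg
          exact setIntegral_mono_set hφi (Eventually.of_forall fun x => norm_nonneg _)
            hG₀G.eventuallyLE
      _ ≤ U * (K * ‖φ‖) := mul_le_mul_of_nonneg_left hφ1 ENNReal.toReal_nonneg
      _ = U * K * ‖φ‖ := by ring

/-- Null controllability along a chain `φ k` with `-Δ (φ k) = φ (k + 1)` in the domain of the
Dirichlet Laplacian forces the vanishing of an entire function of the diffusivity. -/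
theorem IsWeakSolution.hasSum_chainCoeff {α ξ : ℝ} {y₀ : L2 G} {y : ℝ → L2 G}
    (h : IsWeakSolution G G₀ α T ξ y₀ u y) (hyT : y T = 0) (hα₀ : 0 < α) (hα₁ : α < 1)
    (hT : 0 < T) {φ : ℕ → L2 G} (hφ : ∀ k, HasDirichletLaplacian G (φ k) (-φ (k + 1)))
    {C R N : ℝ} (hR : 0 < R) (hN : 0 ≤ N) (hφb : ∀ k, ‖φ k‖ ≤ C * R ^ k)
    (hv : ∀ k, IsBddOn T (N * R ^ k) fun t => ∫ x in G₀, u (t, x) * conj (φ k x)) :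
    HasSum (fun k => (-(ξ : ℂ) * Complex.I) ^ k * chainCoeff α T (fun k => inner ℂ (φ k) y₀)
      (fun k t => ∫ x in G₀, u (t, x) * conj (φ k x)) k) 0 := by
  obtain ⟨hyc, hy0, hw⟩ := h
  obtain ⟨A, hA⟩ := isCompact_Icc.exists_bound_of_continuousOn hyc
  have h0 : (0 : ℝ) ∈ Icc 0 T := ⟨le_rfl, hT.le⟩
  have hA0 : 0 ≤ A := (norm_nonneg _).trans (hA 0 h0)
  have hYb : ∀ k, ∀ t ∈ Icc 0 T, ‖inner ℂ (φ k) (y t)‖ ≤ C * A * R ^ k := fun k t ht =>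
    (norm_inner_le_norm _ _).trans ((mul_le_mul (hφb k) (hA t ht) (norm_nonneg _)
      ((norm_nonneg _).trans (hφb k))).trans_eq (by ring))
  have hYc : ∀ k, ContinuousOn (fun t => inner ℂ (φ k) (y t)) (Icc 0 T) := fun k =>
    continuousOn_const.inner hyc
  have hY := fun k => (hYc k).isBddOn (hYb k)
  have := FracSchrodinger.hasSum_chainCoeff (Y := fun k t => inner ℂ (φ k) (y t))
    (v := fun k t => ∫ x in G₀, u (t, x) * conj (φ k x)) (z := -(ξ : ℂ) * Complex.I)
    hα₀ hT hR hY (fun k => hYb k 0 h0) hv fun k t ht => by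
      have hc := hw _ _ (hφ k)
      simp only [inner_neg_left, mul_neg, ← neg_mul] at hc
      have hC' : 0 ≤ C * A * R ^ (k + 1) := (norm_nonneg _).trans (hYb (k + 1) 0 h0)
      exact hc.sub_eq_fracIntegral hα₀ hα₁ hT (by positivity) (hYc k)
        (((hY (k + 1)).const_mul _).add (hv k)) t ht
  simpa only [hyT, inner_zero_right, hy0] using this

end Control

/-! ### Choice of the chain and conclusion -/

/-- The moments of a bounded function against the kernels of the fractional integrals decay too
fast to be those of a nonzero constant. -/
theorem exists_chainCoeff_ne_zero {α T M : ℝ} (hα₀ : 0 < α) (hα₁ : α < 1) (hT : 0 < T)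
    {a : ℂ} (ha : a ≠ 0) {v : ℝ → ℂ} (hv : IsBddOn T M v) :
    ∃ p, chainCoeff α T (fun _ => a) (fun _ => v) p ≠ 0 := by
  by_contra! h
  have hle : ∀ p : ℕ, ‖a‖ ≤ M * T ^ α *
      (Real.Gamma (α * p + 1) / Real.Gamma (α * p + 1 + α)) := by
    intro p
    have h1 := h p
    have hG : 0 < Real.Gamma (α * p + 1) := Real.Gamma_pos_of_pos (by positivity)
    have hb := norm_fracIntegral_le hv (by positivity : 0 < α + α * p) hT.le
    rw [chainCoeff, add_eq_zero_iff_eq_neg] at h1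
    rw [← norm_neg, ← h1, norm_mul, Complex.norm_real, Real.norm_of_nonneg (by positivity),
      Real.rpow_add hT, show α + α * p + 1 = α * p + 1 + α by ring] at hb
    have hp : 0 < T ^ (α * p) := Real.rpow_pos_of_pos hT _
    rw [div_mul_eq_mul_div, div_le_iff₀ hG] at hb
    refine le_of_mul_le_mul_left (hb.trans_eq ?_) hp
    ring
  have hx : Tendsto (fun p : ℕ => α * (p : ℝ) + 1) atTop atTop :=
    tendsto_atTop_add_const_right _ _ (tendsto_natCast_atTop_atTop.const_mul_atTop hα₀)
  have hlim := ((tendsto_Gamma_div_Gamma_add hα₀ hα₁).comp hx).const_mul (M * T ^ α)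
  rw [mul_zero] at hlim
  exact ha (norm_le_zero_iff.1 (ge_of_tendsto' hlim hle))

theorem countable_setOf_nullControllable {d : ℕ} (hd : 1 ≤ d)
    {G G₀ : Set (EuclideanSpace ℝ (Fin d))} (hG : IsOpen G) (hGb : Bornology.IsBounded G)
    (hG₀G : G₀ ⊆ G) {α T : ℝ} (hα₀ : 0 < α) (hα₁ : α < 1) (hT : 0 < T)
    {y₀ : L2 G} (hy₀ : y₀ ≠ 0) {u : ℝ × EuclideanSpace ℝ (Fin d) → ℂ}
    (hu : MemLp u ∞ (volume.restrict (Ioo (0 : ℝ) T ×ˢ G₀))) :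
    {ξ : ℝ | ∃ y : ℝ → L2 G, IsWeakSolution G G₀ α T ξ y₀ u y ∧ y T = 0}.Countable := by
  obtain ⟨N, hN, hu⟩ := exists_isBddOn_integral_mul_conj hGb hG₀G hu
  set K := dirichletInverse G
  obtain ⟨ψ, B, hψ, hcomm, hKB⟩ := exists_inner_ne_zero_of_bounded_inverse K
    isSelfAdjoint_dirichletInverse (injective_dirichletInverse hd hG hGb) hy₀
  have hpow : ∀ p : ℕ, K (B ((K ^ p) ψ)) = (K ^ p) ψ := fun p => by
    have h1 : Commute (K * B) (K ^ p) :=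
      ((Commute.refl K).pow_right p).mul_left (hcomm.pow_right p)
    have h2 := congrArg (fun A : L2 G →L[ℂ] L2 G => A ψ) h1.eq
    exact h2.trans (congrArg (K ^ p) hKB)
  -- The index can be fixed before the chain: coefficient `p` will see only `φ p`, which is arranged
  -- to be `ψ`.
  obtain ⟨p, hp⟩ := exists_chainCoeff_ne_zero hα₀ hα₁ hT hψ (hu ψ)
  -- `B` undoes `K` on `ψ` and on its images under powers of `K`. The first `p` steps therefore
  -- climb back from `K ^ p ψ` to `ψ`, and later ones continue with growth at most `‖B‖` per step.
  set φ : ℕ → L2 G := fun k => (B ^ k) ((K ^ p) ψ) with hφ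
  have hφp : φ p = ψ := by
    have : ∀ k, (B ^ k) ((K ^ k) ψ) = ψ := by
      intro k
      induction k with
      | zero => rfl
      | succ k ih =>
        have h1 : B ^ (k + 1) * K ^ (k + 1) = B ^ k * K ^ k * (K * B) := by
          rw [pow_succ, pow_succ', mul_assoc, ← mul_assoc B, hcomm.eq,
            (((Commute.refl K).pow_right k).mul_left (hcomm.pow_right k)).eq, ← mul_assoc]
        have h2 := congrArg (fun A : L2 G →L[ℂ] L2 G => A ψ) h1
        exact h2.trans ((congrArg (B ^ k * K ^ k : L2 G →L[ℂ] L2 G) hKB).trans ih)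
    exact this p
  have hKφ : ∀ k, K (φ (k + 1)) = φ k := fun k => by
    have h1 : K * B ^ (k + 1) = B ^ k * (K * B) := by
      rw [pow_succ, ← mul_assoc, ← (hcomm.pow_left k).eq, mul_assoc]
    have h2 := congrArg (fun A : L2 G →L[ℂ] L2 G => A ((K ^ p) ψ)) h1
    exact h2.trans (congrArg (B ^ k) (hpow p))
  have hφΔ : ∀ k, HasDirichletLaplacian G (φ k) (-φ (k + 1)) := fun k => by
    have := hasDirichletLaplacian_dirichletInverse hd hGb (φ (k + 1))
    rwa [show dirichletInverse G (φ (k + 1)) = φ k from hKφ k] at this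
  set R : ℝ := ‖B‖ + 1
  set C : ℝ := ‖(K ^ p) ψ‖
  have hR : 0 < R := by positivity
  have hφb : ∀ k, ‖φ k‖ ≤ C * R ^ k := fun k => by
    induction k with
    | zero => simp [hφ, C]
    | succ k ih =>
      have h1 : φ (k + 1) = B (φ k) := by simp only [hφ, pow_succ']; rfl
      rw [h1, pow_succ, ← mul_assoc, mul_comm _ R]
      refine (B.le_opNorm _).trans (mul_le_mul (by linarith) ih (norm_nonneg _) hR.le)
  have hv : ∀ k, IsBddOn T (N * C * R ^ k) fun t => ∫ x in G₀, u (t, x) * conj (φ k x) :=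
    fun k => ⟨(hu (φ k)).aesm, (hu (φ k)).bdd.mono fun s hs hs' => (hs hs').trans (by
      rw [mul_assoc]; exact mul_le_mul_of_nonneg_left (hφb k) hN)⟩
  have hNC : 0 ≤ N * C := mul_nonneg hN (norm_nonneg _)
  have hinit : ∀ k, ‖(inner ℂ (φ k) y₀ : ℂ)‖ ≤ C * ‖y₀‖ * R ^ k := fun k =>
    (norm_inner_le_norm _ _).trans ((mul_le_mul_of_nonneg_right (hφb k)
      (norm_nonneg _)).trans_eq (by ring))
  have hcount := countable_zeros_of_summable (summable_chainCoeff hα₀ hT hR hinit hv) (p := p) (by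
    simpa only [chainCoeff, hφp] using hp)
  have hinj : Function.Injective fun ξ : ℝ => -(ξ : ℂ) * Complex.I := fun a b hab => by
    simpa using hab
  refine (hcount.preimage hinj).mono ?_
  rintro ξ ⟨y, hy, hyT⟩
  exact hy.hasSum_chainCoeff hyT hα₀ hα₁ hT hφΔ hR hNC hφb hv

end FracSchrodinger

theorem mainTheorem2 {d : ℕ} (hd : 1 ≤ d) (G G₀ : Set (EuclideanSpace ℝ (Fin d)))
    (hG : IsOpen G) (hGb : Bornology.IsBounded G)
    (hG₀ : MeasurableSet G₀) (hG₀G : G₀ ⊆ G) (hG₀pos : 0 < volume G₀)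
    (α T : ℝ) (hα₀ : 0 < α) (hα₁ : α < 1) (hT : 0 < T)
    (y₀ : FracSchrodinger.L2 G) (hy₀ : y₀ ≠ 0)
    (u : ℝ × EuclideanSpace ℝ (Fin d) → ℂ)
    (hu : MemLp u ∞ (volume.restrict (Ioo (0 : ℝ) T ×ˢ G₀)))
    {Ω : Type*} [MeasurableSpace Ω] (P : Measure Ω) [IsProbabilityMeasure P] :
    {ξ : ℝ | ∃ y : ℝ → FracSchrodinger.L2 G,
        FracSchrodinger.IsWeakSolution G G₀ α T ξ y₀ u y ∧ y T = 0}.Countable ∧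
    ∀ ξ : Ω → ℝ, Measurable ξ → P.map ξ ≪ volume →
      P {ω | ∃ y : ℝ → FracSchrodinger.L2 G,
        FracSchrodinger.IsWeakSolution G G₀ α T (ξ ω) y₀ u y ∧ y T = 0} = 0 := by
  have hcount := FracSchrodinger.countable_setOf_nullControllable hd hG hGb hG₀G hα₀ hα₁ hT
    hy₀ hu
  refine ⟨hcount, fun ξ hξ hac => ?_⟩
  -- Countability gives both nullity and the measurability needed to evaluate the law of `ξ` on this
  -- set.
  have h := hac (hcount.measure_zero volume)
  rwa [Measure.map_apply hξ hcount.measurableSet] at h
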